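/- Let $\mathbb{T}\subseteq\mathbb{R}$ be a time scale (a nonempty closed set) and let $a,b\in\mathbb{T}$ with $a<b$. Write $[a,b]_{\mathbb T}=\mathbb T\cap[a,b]$, regarded as a time scale, with forward jump $\sigma(t)=\inf\{s>t\}$ (and $\sigma(b)=b$), backward jump $\rho(t)=\sup\{s<t\}$ (and $\rho(a)=a$), $y^\sigma=y\circ\sigma$, delta derivative $y^\Delta$, and delta integral $\int_a^b f(t)\,\Delta t=F(b)-F(a)$ for any $F$ with $F^\Delta=f$. For a time scale $S$ let $S^\kappa$ be $S$ without its maximum if the latter is left-scattered, and $S^\kappa=S$ otherwise; $S^{\kappa^2}=(S^\kappa)^\kappa$, and $y^{\Delta^2}$ is the delta derivative of $y^\Delta$ on the time scale $[a,b]_{\mathbb T}^{\kappa}$. Assume that either $\rho(b)=b$, or $\rho(\rho(b))<\rho(b)<b$. Let $q:[a,b]^{\kappa}_{\mathbb T}\to\mathbb R$ be continuous. A number $\lambda\in\mathbb R$ is an eigenvalue if there is a twice $\Delta$-differentiable $y:[a,b]_{\mathbb T}\to\mathbb R$, not identically zero (an eigenfunction for $\lambda$), with $$y^{\Delta^2}(t)+q(t)y^\sigma(t)+\lambda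 y^\sigma(t)=0,\quad t\in[a,b]^{\kappa^2}_{\mathbb T},\qquad y(a)=y(b)=0.$$ **Theorem.** There is a least eigenvalue $\lambda_1$, and it has an eigenfunction $y_1$ normalised by $\int_a^b (y_1^\sigma)^2(t)\,\Delta t=1$. Let $y_1$ be any such normalised eigenfunction for $\lambda_1$. Then $y_1$ belongs to the set of all $y\in C^2_{\rm rd}$ (twice $\Delta$-differentiable functions on $[a,b]_{\mathbb T}$ with rd-continuous second $\Delta$-derivative) satisfying $y(a)=y(b)=0$ and $\int_a^b (y^\sigma)^2(t)\,\Delta t=1$, and among these functions the functional $$J[y]=\int_a^b\left[(y^\Delta)^2(t)-q(t)(y^\sigma)^2(t)\right]\Delta t$$ attains its minimum at $y_1$. Moreover $J[y_1]=\lambda_1$. -/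

import Mathlib

open Filter Topology

namespace TimeScale

/-- The time scale interval `[a,b]_𝕋 = {t ∈ 𝕋 : a ≤ t ≤ b}`. It is again a time scale, and the
functions of the eigenvalue problem live on it. -/
def tsIcc (𝕋 : Set ℝ) (a b : ℝ) : Set ℝ := {t | t ∈ 𝕋 ∧ a ≤ t ∧ t ≤ b}

open Classical in
/-- Forward jump operator `σ(t) = inf {s ∈ T : s > t}`, with `σ(M) = M` at a maximum `M`. -/
noncomputable def sigma (T : Set ℝ) (t : ℝ) : ℝ :=
  if ∃ s ∈ T, t < s then sInf {s | s ∈ T ∧ t < s} else t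

open Classical in
/-- Backward jump operator `ρ(t) = sup {s ∈ T : s < t}`, with `ρ(m) = m` at a minimum `m`. -/
noncomputable def rho (T : Set ℝ) (t : ℝ) : ℝ :=
  if ∃ s ∈ T, s < t then sSup {s | s ∈ T ∧ s < t} else t

/-- `T^κ = {t ∈ T : t non-maximal or left-dense}`. -/
def kappa (T : Set ℝ) : Set ℝ := {t | t ∈ T ∧ ((∃ s ∈ T, t < s) ∨ rho T t = t)}

/-- The number `d` is a `Δ`-derivative at `t` of the function `f` on the time scale `T`.
Only the values of `f` on `T` matter; the notion is used at points `t ∈ T^κ`. -/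
def HasDeltaDerivAt (T : Set ℝ) (f : ℝ → ℝ) (d t : ℝ) : Prop :=
  ∀ ε > 0, ∃ δ > 0, ∀ s ∈ T, |s - t| < δ →
    |f (sigma T t) - f s - d * (sigma T t - s)| ≤ ε * |sigma T t - s|

/-- `f` is `Δ`-differentiable at `t`. -/
def DeltaDifferentiableAt (T : Set ℝ) (f : ℝ → ℝ) (t : ℝ) : Prop :=
  ∃ d, HasDeltaDerivAt T f d t

open Classical in
/-- The `Δ`-derivative `f^Δ(t)` (and `0` where `f` is not `Δ`-differentiable). -/
noncomputable def deltaDeriv (T : Set ℝ) (f : ℝ → ℝ) (t : ℝ) : ℝ :=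
  if h : DeltaDifferentiableAt T f t then h.choose else 0

/-- The second `Δ`-derivative `y^{Δ²} = (y^Δ)^Δ`: `y^Δ` is a function on the time scale `T^κ`, and
it is differentiated there. -/
noncomputable def deltaDeriv2 (T : Set ℝ) (y : ℝ → ℝ) (t : ℝ) : ℝ :=
  deltaDeriv (kappa T) (deltaDeriv T y) t

/-- `y` is twice `Δ`-differentiable: `y^Δ` exists on `T^κ` and `y^{Δ²}` exists on `T^{κ²}`. -/
def TwiceDeltaDifferentiable (T : Set ℝ) (y : ℝ → ℝ) : Prop :=
  (∀ t ∈ kappa T, DeltaDifferentiableAt T y t) ∧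
  (∀ t ∈ kappa (kappa T), DeltaDifferentiableAt (kappa T) (deltaDeriv T y) t)

/-- `f : S → ℝ`, with `S ⊆ T` (such as `T`, `T^κ`, `T^{κ²}`), is rd-continuous: it is continuous at
right-dense points and has left-sided limits at left-dense points. Points are classified as
points of `T`. -/
def RdContinuousOn (T S : Set ℝ) (f : ℝ → ℝ) : Prop :=
  ∀ t ∈ S, (sigma T t = t → ContinuousWithinAt f S t) ∧
    (rho T t = t → ∃ l : ℝ, Tendsto f (𝓝[S ∩ Set.Iio t] t) (𝓝 l))

/-- The class `C²_rd`: twice `Δ`-differentiable with rd-continuous second `Δ`-derivative. -/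
def C2rd (T : Set ℝ) (y : ℝ → ℝ) : Prop :=
  TwiceDeltaDifferentiable T y ∧ RdContinuousOn T (kappa (kappa T)) (deltaDeriv2 T y)

/-- `F` is an antiderivative of `f : T^κ → ℝ`. -/
def IsDeltaAntideriv (T : Set ℝ) (F f : ℝ → ℝ) : Prop :=
  ∀ t ∈ kappa T, HasDeltaDerivAt T F (f t) t

open Classical in
/-- The `Δ`-integral `∫_r^s f(t) Δt = F(s) - F(r)`, where `F` is any antiderivative of `f`
(and `0` if there is none). -/
noncomputable def deltaIntegral (T : Set ℝ) (f : ℝ → ℝ) (r s : ℝ) : ℝ :=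
  if h : ∃ F, IsDeltaAntideriv T F f then h.choose s - h.choose r else 0

/-! ### The `Δ`-integral does not depend on the antiderivative -/

theorem sub_le_of_zero_deriv {T : Set ℝ} {G : ℝ → ℝ} (hT : IsClosed T)
    (hG : ∀ t ∈ kappa T, HasDeltaDerivAt T G 0 t) {r s : ℝ} (hr : r ∈ T) (hs : s ∈ T)
    (hrs : r ≤ s) {ε : ℝ} (hε : 0 < ε) : |G s - G r| ≤ ε * (s - r) := by
  by_contra hcon
  set N : Set ℝ := {t | t ∈ T ∧ r ≤ t ∧ ¬ |G t - G r| ≤ ε * (t - r)} with hN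
  have hNne : N.Nonempty := ⟨s, hs, hrs, hcon⟩
  have hNbdd : BddBelow N := ⟨r, fun t ht => ht.2.1⟩
  set x := sInf N with hx
  have hxcl : x ∈ closure N := csInf_mem_closure hNne hNbdd
  have hxT : x ∈ T := by
    have h1 : N ⊆ T := fun t ht => ht.1
    exact hT.closure_subset (closure_mono h1 hxcl)
  have hrx : r ≤ x := le_csInf hNne fun t ht => ht.2.1
  have hbelow : ∀ t ∈ T, r ≤ t → t < x → |G t - G r| ≤ ε * (t - r) := by
    intro t ht hrt htx
    by_contra h
    exact absurd (csInf_le hNbdd (show t ∈ N from ⟨ht, hrt, h⟩)) (not_le.2 htx)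
  -- a zero derivative gives `G (σ t) = G t`
  have hjump : ∀ t ∈ kappa T, G (sigma T t) = G t := by
    intro t ht
    have key : ∀ η > 0, |G (sigma T t) - G t| ≤ η * |sigma T t - t| := by
      intro η hη
      obtain ⟨δ, hδ, h⟩ := hG t ht η hη
      simpa using h t ht.1 (by simpa using hδ)
    have h0 : |G (sigma T t) - G t| ≤ 0 := by
      refine le_of_forall_pos_le_add fun η hη => ?_
      have hp : 0 < |sigma T t - t| + 1 := by positivity
      have h2 := key (η / (|sigma T t - t| + 1)) (by positivity)
      have h3 : η / (|sigma T t - t| + 1) * |sigma T t - t| ≤ η := by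
        rw [div_mul_eq_mul_div, div_le_iff₀ hp]
        nlinarith [abs_nonneg (sigma T t - t)]
      linarith
    have := abs_nonpos_iff.1 h0
    linarith
  have hPx : |G x - G r| ≤ ε * (x - r) := by
    rcases hrx.eq_or_lt with h | hlt
    · rw [← h]; simp
    have hex : ∃ s ∈ T, s < x := ⟨r, hr, hlt⟩
    set P : Set ℝ := {u | u ∈ T ∧ u < x} with hP
    have hPne : P.Nonempty := ⟨r, hr, hlt⟩
    have hPbdd : BddAbove P := ⟨x, fun u hu => hu.2.le⟩
    have hrho : rho T x = sSup P := by rw [rho, if_pos hex]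
    have hple : sSup P ≤ x := csSup_le hPne fun u hu => hu.2.le
    have hpT : sSup P ∈ T := hT.closure_subset
      (closure_mono (fun u hu => hu.1) (csSup_mem_closure hPne hPbdd))
    have hrp : r ≤ sSup P := le_csSup hPbdd ⟨hr, hlt⟩
    rcases hple.eq_or_lt with heq | hplt
    · have hk : x ∈ kappa T := ⟨hxT, Or.inr (hrho.trans heq)⟩
      refine le_of_forall_pos_le_add fun η hη => ?_
      have hp : 0 < |sigma T x - x| + 1 := by positivity
      obtain ⟨δ, hδ, h⟩ := hG x hk (η / (|sigma T x - x| + 1)) (by positivity)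
      obtain ⟨u, hu, hux⟩ := exists_lt_of_lt_csSup hPne
        (show max (max (x - δ) (x - 1)) r < sSup P by
          rw [heq]; exact max_lt (max_lt (by linarith) (by linarith)) hlt)
      have hu1 : x - δ < u := lt_of_le_of_lt ((le_max_left _ _).trans (le_max_left _ _)) hux
      have hu2 : x - 1 < u := lt_of_le_of_lt ((le_max_right _ _).trans (le_max_left _ _)) hux
      have hu3 : r < u := lt_of_le_of_lt (le_max_right _ _) hux
      have h1 := h u hu.1 (by rw [abs_lt]; constructor <;> linarith [hu.2])
      rw [hjump x hk] at h1
      have h2 : |sigma T x - u| ≤ |sigma T x - x| + 1 := by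
        calc |sigma T x - u| ≤ |sigma T x - x| + |x - u| := abs_sub_le _ _ _
          _ ≤ _ := by
            have : |x - u| ≤ 1 := by rw [abs_le]; constructor <;> linarith [hu.2]
            linarith
      have h3 : |G x - G u| ≤ η := by
        have h4 : η / (|sigma T x - x| + 1) * |sigma T x - u| ≤ η := by
          rw [div_mul_eq_mul_div, div_le_iff₀ hp]
          exact mul_le_mul_of_nonneg_left h2 hη.le
        have h5 : |G x - G u| ≤ η / (|sigma T x - x| + 1) * |sigma T x - u| := by simpa using h1
        exact h5.trans h4
      have h6 := hbelow u hu.1 hu3.le hu.2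
      have h7 := abs_sub_le (G x) (G u) (G r)
      nlinarith [hu.2]
    · have hk : sSup P ∈ kappa T := ⟨hpT, Or.inl ⟨x, hxT, hplt⟩⟩
      have hsig : sigma T (sSup P) = x := by
        rw [sigma, if_pos ⟨x, hxT, hplt⟩]
        apply le_antisymm
        · exact csInf_le ⟨sSup P, fun u hu => hu.2.le⟩ ⟨hxT, hplt⟩
        · refine le_csInf ⟨x, hxT, hplt⟩ fun u hu => ?_
          by_contra hux
          exact absurd (le_csSup hPbdd (show u ∈ P from ⟨hu.1, not_le.1 hux⟩)) (not_le.2 hu.2)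
      have h1 := hjump _ hk
      rw [hsig] at h1
      rw [h1]
      have h2 := hbelow _ hpT hrp hplt
      nlinarith
  have hxN : x ∉ N := fun h => h.2.2 hPx
  have hgt : ∀ u ∈ N, x < u := fun u hu =>
    lt_of_le_of_ne (csInf_le hNbdd hu) fun h => hxN (h ▸ hu)
  obtain ⟨u₀, hu₀⟩ := hNne
  have hk : x ∈ kappa T := ⟨hxT, Or.inl ⟨u₀, hu₀.1, hgt u₀ hu₀⟩⟩
  have hsig : sigma T x = x := by
    rw [sigma, if_pos ⟨u₀, hu₀.1, hgt u₀ hu₀⟩]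
    apply le_antisymm
    · have hb : BddBelow {s | s ∈ T ∧ x < s} := ⟨x, fun u hu => hu.2.le⟩
      exact csInf_le_csInf hb ⟨u₀, hu₀⟩ fun u hu => ⟨hu.1, hgt u hu⟩
    · exact le_csInf ⟨u₀, hu₀.1, hgt u₀ hu₀⟩ fun u hu => hu.2.le
  obtain ⟨δ, hδ, h⟩ := hG x hk ε hε
  obtain ⟨u, hu, hux⟩ := exists_lt_of_csInf_lt (⟨u₀, hu₀⟩ : N.Nonempty)
    (show sInf N < x + δ by linarith)
  have hxu := hgt u hu
  have h1 := h u hu.1 (by rw [abs_lt]; constructor <;> linarith)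
  rw [hsig] at h1
  have h2 : |G x - G u| ≤ ε * (u - x) := by
    have h3 : |x - u| = u - x := by rw [abs_sub_comm, abs_of_pos (by linarith)]
    rw [h3] at h1
    simpa using h1
  refine hu.2.2 ?_
  have h4 := abs_sub_le (G u) (G x) (G r)
  rw [abs_sub_comm (G u) (G x)] at h4
  linarith

/-- Any antiderivative computes the `Δ`-integral. -/
theorem deltaIntegral_eq {T : Set ℝ} {F f : ℝ → ℝ} (hT : IsClosed T)
    (hF : IsDeltaAntideriv T F f) {r s : ℝ} (hr : r ∈ T) (hs : s ∈ T) (hrs : r ≤ s) :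
    deltaIntegral T f r s = F s - F r := by
  have hex : ∃ F, IsDeltaAntideriv T F f := ⟨F, hF⟩
  rw [deltaIntegral, dif_pos hex]
  have hG : ∀ t ∈ kappa T, HasDeltaDerivAt T (fun t => hex.choose t - F t) 0 t := by
    intro t ht ε hε
    obtain ⟨δ₁, hδ₁, h₁⟩ := hex.choose_spec t ht (ε / 2) (by positivity)
    obtain ⟨δ₂, hδ₂, h₂⟩ := hF t ht (ε / 2) (by positivity)
    refine ⟨min δ₁ δ₂, lt_min hδ₁ hδ₂, fun u hu hut => ?_⟩
    have e₁ := abs_le.1 (h₁ u hu (lt_of_lt_of_le hut (min_le_left _ _)))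
    have e₂ := abs_le.1 (h₂ u hu (lt_of_lt_of_le hut (min_le_right _ _)))
    rw [abs_le]
    constructor <;> linarith [e₁.1, e₁.2, e₂.1, e₂.2]
  have h0 : |(hex.choose s - F s) - (hex.choose r - F r)| ≤ 0 := by
    refine le_of_forall_pos_le_add fun η hη => ?_
    have hp : 0 < s - r + 1 := by linarith
    have h2 := sub_le_of_zero_deriv hT hG hr hs hrs (show 0 < η / (s - r + 1) by positivity)
    have h3 : η / (s - r + 1) * (s - r) ≤ η := by
      rw [div_mul_eq_mul_div, div_le_iff₀ hp]
      nlinarith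
    linarith
  have := abs_nonpos_iff.1 h0
  linarith

/-! ### The Sturm–Liouville problem -/

/-- `y` is an eigenfunction for `lam`: a nontrivial solution on `T = [a,b]_𝕋` of
`y^{Δ²}(t) + q(t) y^σ(t) + lam y^σ(t) = 0`, `t ∈ T^{κ²}`, with `y(a) = y(b) = 0`. -/
structure IsEigenfunction (T : Set ℝ) (a b : ℝ) (q : ℝ → ℝ) (lam : ℝ) (y : ℝ → ℝ) : Prop where
  twice : TwiceDeltaDifferentiable T y
  eqn : ∀ t ∈ kappa (kappa T),
    deltaDeriv2 T y t + q t * y (sigma T t) + lam * y (sigma T t) = 0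
  left : y a = 0
  right : y b = 0
  nontrivial : ∃ t ∈ T, y t ≠ 0

/-- `lam` is an eigenvalue. -/
def IsEigenvalue (T : Set ℝ) (a b : ℝ) (q : ℝ → ℝ) (lam : ℝ) : Prop :=
  ∃ y, IsEigenfunction T a b q lam y

/-- `lam` is the first (least) eigenvalue. -/
def IsFirstEigenvalue (T : Set ℝ) (a b : ℝ) (q : ℝ → ℝ) (lam : ℝ) : Prop :=
  IsLeast {l | IsEigenvalue T a b q l} lam

/-- The functional `J[y] = ∫_a^b [(y^Δ)²(t) - q(t) (y^σ)²(t)] Δt`. -/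
noncomputable def functionalJ (T : Set ℝ) (a b : ℝ) (q y : ℝ → ℝ) : ℝ :=
  deltaIntegral T (fun t => (deltaDeriv T y t) ^ 2 - q t * (y (sigma T t)) ^ 2) a b

/-- The isoperimetric functional `I[y] = ∫_a^b (y^σ)²(t) Δt`. -/
noncomputable def functionalI (T : Set ℝ) (a b : ℝ) (y : ℝ → ℝ) : ℝ :=
  deltaIntegral T (fun t => (y (sigma T t)) ^ 2) a b

/-- The competitors: `y ∈ C²_rd` with `y(a) = y(b) = 0` and `I[y] = 1`. -/
structure IsAdmissible (T : Set ℝ) (a b : ℝ) (y : ℝ → ℝ) : Prop where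
  c2rd : C2rd T y
  left : y a = 0
  right : y b = 0
  constraint : functionalI T a b y = 1

end TimeScale

namespace TimeScale

/-! The argument rests on Picone's identity and a continuity method in the spectral parameter; no
spectral theory or compactness of minimising sequences is used. With `r = q + l`, the equation is
treated as the system u^Δ = v, v^Δ = -r u^σ (`IsSolution`). If a solution u is positive on all of T,
then for every Δ-differentiable y, (y² v/u)^Δ = (y^Δ)² - r (y^σ)² - (y^Δ u - y v)²/(u u^σ).
Integration gives J[y] ≥ l I[y] whenever y vanishes at a and b (`IsSolution.isNonnegForm`).

Let u_l be the solution with u_l(a) = 0 and v_l(a) = 1, and let Λ be the set of l for which u_l > 0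
on (a,b]. For l in Λ the inequality still holds, after adding to u_l a small multiple of a solution
equal to 1 at a. Λ contains all very negative l, and the Rayleigh quotient of one test function
bounds it above. At l₁ = sup Λ the limit u is nonnegative. An interior zero would force v = 0 there,
against the constant Wronskian; and u(b) > 0 would allow l to be increased. Hence u(b) = 0, so u is
an eigenfunction, and J ≥ l₁ I survives in the limit (`exists_first_solution`).

Every eigenfunction for l satisfies J = l I, by integrating (y y^Δ)^Δ
(`IsEigenfunction.functionalJ_eq`), and I > 0 for it. So J ≥ l₁ I shows both that l₁ is the least
eigenvalue and that a normalised eigenfunction for it minimises J.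

The analytic groundwork is the existence of Δ-antiderivatives (`Regular.exists_antideriv`) and of
solutions depending continuously on l, obtained by inverting 1 + K for a Volterra operator K on C(T)
(`exists_solution_family`). The hypothesis on ρ(b) ensures that T^κ has a point beyond a, and that
Δ-derivatives over T^κ and over T agree on T^{κ²}. -/

/-- `T` is a compact time scale with minimum `a` and maximum `b > a`. -/
structure IsInterval (T : Set ℝ) (a b : ℝ) : Prop where
  closed : IsClosed T
  left_mem : a ∈ T
  right_mem : b ∈ T
  subset : T ⊆ Set.Icc a b
  lt : a < b

variable {T : Set ℝ} {a b : ℝ}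

/-! ### The jump operators -/

theorem le_sigma (t : ℝ) : t ≤ sigma T t := by
  unfold sigma
  split_ifs with h
  · obtain ⟨s, hs, hts⟩ := h
    exact le_csInf ⟨s, hs, hts⟩ fun u hu => hu.2.le
  · exact le_rfl

theorem sigma_le {t s : ℝ} (hs : s ∈ T) (hts : t < s) : sigma T t ≤ s := by
  rw [sigma, if_pos ⟨s, hs, hts⟩]
  exact csInf_le ⟨t, fun u hu => hu.2.le⟩ ⟨hs, hts⟩

theorem rho_le (t : ℝ) : rho T t ≤ t := by
  unfold rho
  split_ifs with h
  · obtain ⟨s, hs, hts⟩ := h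
    exact csSup_le ⟨s, hs, hts⟩ fun u hu => hu.2.le
  · exact le_rfl

theorem le_rho {t s : ℝ} (hs : s ∈ T) (hts : s < t) : s ≤ rho T t := by
  rw [rho, if_pos ⟨s, hs, hts⟩]
  exact le_csSup ⟨t, fun u hu => hu.2.le⟩ ⟨hs, hts⟩

theorem sigma_mem (hT : IsClosed T) {t : ℝ} (ht : t ∈ T) : sigma T t ∈ T := by
  unfold sigma
  split_ifs with h
  · obtain ⟨s, hs, hts⟩ := h
    exact hT.closure_subset (closure_mono (fun u hu => hu.1)
      (csInf_mem_closure ⟨s, hs, hts⟩ ⟨t, fun u (hu : u ∈ T ∧ t < u) => hu.2.le⟩))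
  · exact ht

theorem rho_mem (hT : IsClosed T) {t : ℝ} (ht : t ∈ T) : rho T t ∈ T := by
  unfold rho
  split_ifs with h
  · obtain ⟨s, hs, hts⟩ := h
    exact hT.closure_subset (closure_mono (fun u hu => hu.1)
      (csSup_mem_closure ⟨s, hs, hts⟩ ⟨t, fun u (hu : u ∈ T ∧ u < t) => hu.2.le⟩))
  · exact ht

theorem sigma_rho {t : ℝ} (ht : t ∈ T) (h : rho T t < t) : sigma T (rho T t) = t := by
  refine le_antisymm (sigma_le ht h) ?_
  rw [sigma, if_pos ⟨t, ht, h⟩]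
  refine le_csInf ⟨t, ht, h⟩ fun u hu => ?_
  by_contra hut
  exact absurd (le_rho hu.1 (not_le.1 hut)) (not_le.2 hu.2)

theorem exists_mem_right {t s δ : ℝ} (hs : s ∈ T) (hts : t < s) (h : sigma T t = t)
    (hδ : 0 < δ) : ∃ u ∈ T, t < u ∧ u < t + δ := by
  by_contra! hc
  have : t + δ ≤ sigma T t := by
    rw [sigma, if_pos ⟨s, hs, hts⟩]
    exact le_csInf ⟨s, hs, hts⟩ fun u hu => hc u hu.1 hu.2
  linarith

theorem exists_mem_left {t s δ : ℝ} (hs : s ∈ T) (hts : s < t) (h : rho T t = t)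
    (hδ : 0 < δ) : ∃ u ∈ T, t - δ < u ∧ u < t := by
  by_contra! hc
  have : rho T t ≤ t - δ := by
    rw [rho, if_pos ⟨s, hs, hts⟩]
    refine csSup_le ⟨s, hs, hts⟩ fun u hu => ?_
    by_contra hut
    exact absurd (hc u hu.1 (not_le.1 hut)) (not_le.2 hu.2)
  linarith

theorem sigma_mono {s t : ℝ} (ht : t ∈ T) (hst : s ≤ t) : sigma T s ≤ sigma T t := by
  rcases hst.eq_or_lt with rfl | h
  · exact le_rfl
  · exact (sigma_le ht h).trans (le_sigma t)

/-- `σ` is continuous at right-dense points. -/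
theorem continuousWithinAt_sigma {t : ℝ} (ht : t ∈ T) (h : sigma T t = t) :
    ContinuousWithinAt (sigma T) T t := by
  rw [Metric.continuousWithinAt_iff]
  intro ε hε
  by_cases hm : ∃ s ∈ T, t < s
  · obtain ⟨s, hs, hts⟩ := hm
    obtain ⟨p, hp, htp, hpε⟩ := exists_mem_right hs hts h hε
    refine ⟨min ε (p - t), lt_min hε (by linarith), fun x hx hxt => ?_⟩
    rw [h, Real.dist_eq]
    rw [Real.dist_eq] at hxt
    have h1 := abs_lt.1 (hxt.trans_le (min_le_left _ _))
    have h2 := abs_lt.1 (hxt.trans_le (min_le_right _ _))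
    have h3 : sigma T x ≤ p := sigma_le hp (by linarith)
    have h4 := le_sigma (T := T) x
    rw [abs_lt]; constructor <;> linarith
  · push Not at hm
    refine ⟨ε, hε, fun x hx hxt => ?_⟩
    rw [h, Real.dist_eq]
    rw [Real.dist_eq] at hxt
    have h1 := abs_lt.1 hxt
    have h3 := (sigma_mono ht (hm x hx)).trans h.le
    have h4 := le_sigma (T := T) x
    rw [abs_lt]; constructor <;> linarith

theorem tendsto_sigma_left {t : ℝ} (ht : t ∈ T) :
    Tendsto (sigma T) (𝓝[T ∩ Set.Iio t] t) (𝓝 t) := by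
  refine tendsto_of_tendsto_of_tendsto_of_le_of_le' (g := id) (h := fun _ => t)
    (tendsto_id.mono_left nhdsWithin_le_nhds) tendsto_const_nhds
    (Eventually.of_forall fun x => le_sigma x) ?_
  filter_upwards [self_mem_nhdsWithin] with x hx using sigma_le ht hx.2

/-- This is what makes the Δ-derivative unique on T^κ: the defining inequality can be divided by
|σ(t) - s| at points s arbitrarily close to t. -/
theorem exists_ne_sigma {t δ : ℝ} (ht : t ∈ kappa T) (hne : ∃ s ∈ T, s ≠ t) (hδ : 0 < δ) :
    ∃ s ∈ T, |s - t| < δ ∧ s ≠ sigma T t := by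
  by_cases h : sigma T t = t
  · rw [h]
    by_cases hm : ∃ s ∈ T, t < s
    · obtain ⟨s, hs, hts⟩ := hm
      obtain ⟨u, hu, h1, h2⟩ := exists_mem_right hs hts h hδ
      exact ⟨u, hu, by rw [abs_lt]; constructor <;> linarith, h1.ne'⟩
    · have hr := ht.2.resolve_left hm
      push Not at hm
      obtain ⟨s, hs, hst⟩ := hne
      obtain ⟨u, hu, h1, h2⟩ := exists_mem_left hs (lt_of_le_of_ne (hm s hs) hst) hr hδ
      exact ⟨u, hu, by rw [abs_lt]; constructor <;> linarith, h2.ne⟩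
  · exact ⟨t, ht.1, by simpa using hδ, Ne.symm h⟩

theorem kappa_subset : kappa T ⊆ T := fun _ ht => ht.1

/-- The points of `T` outside `T^κ` are isolated. -/
theorem nhdsWithin_eq_pure_of_notMem_kappa {t : ℝ} (ht : t ∈ T) (h : t ∉ kappa T) :
    𝓝[T] t = pure t := by
  have h1 : ¬ ((∃ s ∈ T, t < s) ∨ rho T t = t) := fun hc => h ⟨ht, hc⟩
  push Not at h1
  have h2 : rho T t < t := lt_of_le_of_ne (rho_le t) h1.2
  have h3 : T ∩ Set.Ioi (rho T t) = {t} := by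
    ext s
    simp only [Set.mem_inter_iff, Set.mem_Ioi, Set.mem_singleton_iff]
    constructor
    · rintro ⟨hs, hr⟩
      refine le_antisymm (h1.1 s hs) (not_lt.1 fun hst => ?_)
      exact absurd (le_rho hs hst) (not_le.2 hr)
    · rintro rfl
      exact ⟨ht, h2⟩
  rw [← nhdsWithin_inter_of_mem' (nhdsWithin_le_nhds (Ioi_mem_nhds h2)), h3,
    nhdsWithin_singleton]

theorem continuousOn_of_kappa {f : ℝ → ℝ}
    (hf : ∀ t ∈ kappa T, ContinuousWithinAt f T t) : ContinuousOn f T := by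
  intro t ht
  by_cases h : t ∈ kappa T
  · exact hf t h
  · rw [ContinuousWithinAt, nhdsWithin_eq_pure_of_notMem_kappa ht h]
    exact tendsto_pure_nhds f t

/-- A point removed from T by κ is an isolated maximum, so T and T^κ coincide near every point of
T^κ. Thus q, given on T^κ only, may be treated as continuous on T whatever its value at b. -/
theorem continuousOn_of_continuousOn_kappa {f : ℝ → ℝ}
    (hf : ContinuousOn f (kappa T)) : ContinuousOn f T := by
  refine continuousOn_of_kappa fun t ht => ?_
  have h : 𝓝[T] t = 𝓝[kappa T] t := by
    by_cases hk : kappa T = T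
    · rw [hk]
    obtain ⟨m, hm, hmk⟩ := Set.exists_of_ssubset (kappa_subset.ssubset_of_ne hk)
    have hmt : t ≠ m := fun h => hmk (h ▸ ht)
    rw [← nhdsWithin_inter_of_mem' (t := {m}ᶜ) (nhdsWithin_le_nhds (isOpen_ne.mem_nhds hmt))]
    apply le_antisymm
    · refine nhdsWithin_mono _ fun s hs => ⟨hs.1, Or.inl ⟨m, hm, ?_⟩⟩
      refine lt_of_le_of_ne (not_lt.1 fun hlt => hmk ⟨hm, Or.inl ⟨s, hs.1, hlt⟩⟩) hs.2
    · exact nhdsWithin_mono _ fun s hs => ⟨hs.1, fun h => hmk (h ▸ hs)⟩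
  rw [ContinuousWithinAt, h]
  exact hf t ht

/-! ### Rules for the `Δ`-derivative -/

/-- The bridge to ordinary calculus. At a right-dense point only the third condition has content; at
a right-scattered point it is vacuous, and the derivative is a difference quotient together with
continuity. The algebraic rules below reduce to this description. -/
theorem hasDeltaDerivAt_iff {f : ℝ → ℝ} {d t : ℝ} (ht : t ∈ T) :
    HasDeltaDerivAt T f d t ↔ ContinuousWithinAt f T t ∧
      f (sigma T t) = f t + d * (sigma T t - t) ∧
      (sigma T t = t → HasDerivWithinAt f d T t) := by
  have hd : sigma T t = t → (HasDeltaDerivAt T f d t ↔ HasDerivWithinAt f d T t) := by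
    intro h
    rw [hasDerivWithinAt_iff_isLittleO, Asymptotics.isLittleO_iff, HasDeltaDerivAt]
    refine forall₂_congr fun ε hε => ?_
    rw [(nhdsWithin_hasBasis Metric.nhds_basis_ball T).eventually_iff]
    refine exists_congr fun δ => and_congr_right fun hδ => ?_
    constructor
    · intro H s hs
      have := H s hs.2 (by simpa [Real.dist_eq] using hs.1)
      rw [h] at this
      rw [Real.norm_eq_abs, Real.norm_eq_abs, abs_sub_comm s t]
      convert this using 1
      rw [← abs_neg]; congr 1; simp only [smul_eq_mul]; ring
    · intro H s hs hst
      have := H (x := s) ⟨by simpa [Real.dist_eq] using hst, hs⟩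
      rw [h]
      rw [Real.norm_eq_abs, Real.norm_eq_abs, abs_sub_comm s t] at this
      convert this using 1
      rw [← abs_neg]; congr 1; simp only [smul_eq_mul]; ring
  by_cases h : sigma T t = t
  · rw [hd h]
    constructor
    · intro H
      exact ⟨H.continuousWithinAt, by rw [h]; ring, fun _ => H⟩
    · exact fun H => H.2.2 h
  · have hpos : 0 < sigma T t - t := by
      have := lt_of_le_of_ne (le_sigma (T := T) t) (Ne.symm h); linarith
    constructor
    · intro H
      -- Taking s = t in the definition, where every ε is allowed, turns the inequality into an
      -- equality.
      have e : f (sigma T t) = f t + d * (sigma T t - t) := by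
        have : |f (sigma T t) - f t - d * (sigma T t - t)| ≤ 0 := by
          refine le_of_forall_pos_le_add fun η hη => ?_
          obtain ⟨δ, hδ, h1⟩ := H (η / (sigma T t - t)) (by positivity)
          have := h1 t ht (by simpa using hδ)
          rw [abs_of_pos hpos, div_mul_cancel₀ _ hpos.ne'] at this
          linarith
        have := abs_nonpos_iff.1 this
        linarith
      refine ⟨?_, e, fun h' => absurd h' h⟩
      rw [Metric.continuousWithinAt_iff]
      intro η hη
      set μ := sigma T t - t with hμ
      obtain ⟨δ, hδ, h1⟩ := H (η / (4 * μ)) (by positivity)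
      have hdp : 0 < |d| + 1 := by positivity
      refine ⟨min δ (min μ (η / (4 * (|d| + 1)))), by positivity, fun {s} hs hst => ?_⟩
      rw [Real.dist_eq] at hst ⊢
      have h2 := hst.trans_le (min_le_left _ _)
      have h3 := hst.trans_le ((min_le_right _ _).trans (min_le_left _ _))
      have h4 := hst.trans_le ((min_le_right _ _).trans (min_le_right _ _))
      have h5 := h1 s hs h2
      have h6 : |sigma T t - s| ≤ 2 * μ := by
        rw [abs_lt] at h3; rw [abs_le]; constructor <;> linarith
      have h7 : η / (4 * μ) * |sigma T t - s| ≤ η / 2 := by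
        calc _ ≤ η / (4 * μ) * (2 * μ) := by gcongr
          _ = η / 2 := by field_simp; norm_num
      have h8 : |d * (s - t)| ≤ η / 4 := by
        rw [abs_mul]
        calc |d| * |s - t| ≤ (|d| + 1) * (η / (4 * (|d| + 1))) := by
              gcongr; linarith
          _ = η / 4 := by field_simp
      rw [e] at h5
      have h9 := abs_le.1 (h5.trans h7)
      have h10 := abs_le.1 h8
      rw [abs_lt]
      constructor <;> linarith
    · rintro ⟨H, e, -⟩ ε hε
      set μ := sigma T t - t with hμ
      have hdp : 0 < |d| + 1 := by positivity
      obtain ⟨δ, hδ, h1⟩ := Metric.continuousWithinAt_iff.1 H (ε * μ / 4) (by positivity)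
      refine ⟨min δ (min (μ / 2) (ε * μ / (4 * (|d| + 1)))), by positivity, fun s hs hst => ?_⟩
      have h2 := h1 hs (hst.trans_le (min_le_left _ _))
      rw [Real.dist_eq] at h2
      have h3 := abs_lt.1 (hst.trans_le ((min_le_right _ _).trans (min_le_left _ _)))
      have h4 := hst.trans_le ((min_le_right _ _).trans (min_le_right _ _))
      have h6 : μ / 2 ≤ |sigma T t - s| := by
        rw [le_abs]; left; linarith
      have h8 : |d * (s - t)| ≤ ε * μ / 4 := by
        rw [abs_mul]
        calc |d| * |s - t| ≤ (|d| + 1) * (ε * μ / (4 * (|d| + 1))) := by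
              gcongr; linarith
          _ = ε * μ / 4 := by field_simp
      calc |f (sigma T t) - f s - d * (sigma T t - s)|
          = |d * (s - t) - (f s - f t)| := by rw [e]; congr 1; rw [hμ]; ring
        _ ≤ |d * (s - t)| + |f s - f t| := abs_sub _ _
        _ ≤ ε * (μ / 2) := by linarith
        _ ≤ ε * |sigma T t - s| := by gcongr

variable {f g : ℝ → ℝ} {d e t : ℝ}

theorem HasDeltaDerivAt.continuousWithinAt (h : HasDeltaDerivAt T f d t) (ht : t ∈ T) :
    ContinuousWithinAt f T t := ((hasDeltaDerivAt_iff ht).1 h).1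

theorem HasDeltaDerivAt.sigma_eq (h : HasDeltaDerivAt T f d t) (ht : t ∈ T) :
    f (sigma T t) = f t + d * (sigma T t - t) := ((hasDeltaDerivAt_iff ht).1 h).2.1

theorem HasDeltaDerivAt.congr (hT : IsClosed T) (ht : t ∈ T) (h : HasDeltaDerivAt T f d t)
    (hfg : ∀ s ∈ T, g s = f s) : HasDeltaDerivAt T g d t := by
  intro ε hε
  obtain ⟨δ, hδ, H⟩ := h ε hε
  refine ⟨δ, hδ, fun s hs hst => ?_⟩
  rw [hfg s hs, hfg _ (sigma_mem hT ht)]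
  exact H s hs hst

theorem hasDeltaDerivAt_const (c : ℝ) (ht : t ∈ T) : HasDeltaDerivAt T (fun _ => c) 0 t :=
  (hasDeltaDerivAt_iff ht).2
    ⟨continuousWithinAt_const, by ring, fun _ => hasDerivWithinAt_const _ _ _⟩

theorem hasDeltaDerivAt_id (ht : t ∈ T) : HasDeltaDerivAt T (fun x => x) 1 t :=
  (hasDeltaDerivAt_iff ht).2
    ⟨continuousWithinAt_id, by ring, fun _ => hasDerivWithinAt_id _ _⟩

theorem HasDeltaDerivAt.add (hf : HasDeltaDerivAt T f d t) (hg : HasDeltaDerivAt T g e t)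
    (ht : t ∈ T) : HasDeltaDerivAt T (fun x => f x + g x) (d + e) t := by
  rw [hasDeltaDerivAt_iff ht] at *
  exact ⟨hf.1.add hg.1, by rw [hf.2.1, hg.2.1]; ring, fun h => (hf.2.2 h).add (hg.2.2 h)⟩

theorem HasDeltaDerivAt.mul (hf : HasDeltaDerivAt T f d t) (hg : HasDeltaDerivAt T g e t)
    (ht : t ∈ T) : HasDeltaDerivAt T (fun x => f x * g x) (d * g t + f (sigma T t) * e) t := by
  rw [hasDeltaDerivAt_iff ht] at *
  exact ⟨hf.1.mul hg.1, by rw [hf.2.1, hg.2.1]; ring, fun h => by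
    rw [h]; exact (hf.2.2 h).mul (hg.2.2 h)⟩

theorem HasDeltaDerivAt.const_mul (c : ℝ) (hf : HasDeltaDerivAt T f d t) (ht : t ∈ T) :
    HasDeltaDerivAt T (fun x => c * f x) (c * d) t := by
  simpa using (hasDeltaDerivAt_const c ht).mul hf ht

theorem HasDeltaDerivAt.sub (hf : HasDeltaDerivAt T f d t) (hg : HasDeltaDerivAt T g e t)
    (ht : t ∈ T) : HasDeltaDerivAt T (fun x => f x - g x) (d - e) t := by
  have := hf.add (hg.const_mul (-1) ht) ht
  simpa only [neg_one_mul, ← sub_eq_add_neg] using this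

theorem HasDeltaDerivAt.inv (hf : HasDeltaDerivAt T f d t) (ht : t ∈ T) (h0 : f t ≠ 0)
    (h1 : f (sigma T t) ≠ 0) :
    HasDeltaDerivAt T (fun x => (f x)⁻¹) (-d / (f t * f (sigma T t))) t := by
  rw [hasDeltaDerivAt_iff ht] at *
  refine ⟨hf.1.inv₀ h0, ?_, fun h => by rw [h, ← sq]; exact (hf.2.2 h).fun_inv h0⟩
  have := hf.2.1
  field_simp
  linarith

theorem HasDeltaDerivAt.unique (hf : HasDeltaDerivAt T f d t) (hg : HasDeltaDerivAt T f e t)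
    (ht : t ∈ kappa T) (hne : ∃ s ∈ T, s ≠ t) : d = e := by
  have : |d - e| ≤ 0 := by
    refine le_of_forall_pos_le_add fun η hη => ?_
    obtain ⟨δ₁, hδ₁, h₁⟩ := hf (η / 2) (by positivity)
    obtain ⟨δ₂, hδ₂, h₂⟩ := hg (η / 2) (by positivity)
    obtain ⟨s, hs, hst, hsσ⟩ := exists_ne_sigma ht hne (lt_min hδ₁ hδ₂)
    have e₁ := h₁ s hs (hst.trans_le (min_le_left _ _))
    have e₂ := h₂ s hs (hst.trans_le (min_le_right _ _))
    have hp : 0 < |sigma T t - s| := abs_pos.2 (sub_ne_zero.2 hsσ.symm)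
    have e₃ : |d - e| * |sigma T t - s| ≤ η * |sigma T t - s| := by
      rw [← abs_mul]
      calc |(d - e) * (sigma T t - s)|
          = |(f (sigma T t) - f s - e * (sigma T t - s)) -
              (f (sigma T t) - f s - d * (sigma T t - s))| := by congr 1; ring
        _ ≤ _ := abs_sub _ _
        _ ≤ η * |sigma T t - s| := by linarith
    have := le_of_mul_le_mul_right e₃ hp
    linarith
  have := abs_nonpos_iff.1 this
  linarith

theorem DeltaDifferentiableAt.hasDeltaDerivAt (h : DeltaDifferentiableAt T f t) :
    HasDeltaDerivAt T f (deltaDeriv T f t) t := by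
  rw [deltaDeriv, dif_pos h]
  exact h.choose_spec

theorem HasDeltaDerivAt.deltaDeriv_eq (hf : HasDeltaDerivAt T f d t) (ht : t ∈ kappa T)
    (hne : ∃ s ∈ T, s ≠ t) : deltaDeriv T f t = d :=
  (DeltaDifferentiableAt.hasDeltaDerivAt ⟨d, hf⟩).unique hf ht hne

theorem IsDeltaAntideriv.continuousOn (h : IsDeltaAntideriv T f g) : ContinuousOn f T :=
  continuousOn_of_kappa fun t ht => (h t ht).continuousWithinAt ht.1

/-! ### The mean value inequality -/

theorem mem_kappa_of_lt {s : ℝ} (ht : t ∈ T) (hs : s ∈ T) (hts : t < s) : t ∈ kappa T :=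
  ⟨ht, Or.inl ⟨s, hs, hts⟩⟩

/-- For ε > 0 the points x of T in [r,s] with f(x) ≥ f(r) - ε(x - r) form a compact set. Its
greatest element cannot lie below s: from there one can move on to σ(x), or to a nearby point of T
if x is right-dense. Then ε tends to 0. The sign of g at s itself plays no role. -/
theorem IsDeltaAntideriv.le_of_nonneg (hT : IsClosed T) (h : IsDeltaAntideriv T f g) {r s : ℝ}
    (hr : r ∈ T) (hs : s ∈ T) (hrs : r ≤ s) (h0 : ∀ x ∈ T, r ≤ x → x < s → 0 ≤ g x) :
    f r ≤ f s := by
  have key : ∀ ε > 0, f r - ε * (s - r) ≤ f s := by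
    intro ε hε
    set P : Set ℝ := {x | x ∈ T ∩ Set.Icc r s ∧ f r - ε * (x - r) ≤ f x} with hP
    have hcl : IsClosed (T ∩ Set.Icc r s) := hT.inter isClosed_Icc
    have hPc : IsCompact P := by
      refine (isCompact_Icc (a := r) (b := s)).of_isClosed_subset ?_ fun x hx => hx.1.2
      exact hcl.isClosed_le (by fun_prop) (h.continuousOn.mono Set.inter_subset_left)
    obtain ⟨x, hxP, hxm⟩ := hPc.exists_isGreatest
      ⟨r, ⟨hr, le_rfl, hrs⟩, by simp⟩
    rcases hxP.1.2.2.eq_or_lt with rfl | hlt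
    · exact hxP.2
    exfalso
    have hk : x ∈ kappa T := mem_kappa_of_lt hxP.1.1 hs hlt
    have hg := h0 x hxP.1.1 hxP.1.2.1 hlt
    by_cases hσ : sigma T x = x
    · obtain ⟨δ, hδ, H⟩ := h x hk ε hε
      obtain ⟨u, hu, hu1, hu2⟩ := exists_mem_right hs hlt hσ
        (lt_min hδ (show 0 < s - x by linarith))
      have hu3 := hu2.trans_le (add_le_add le_rfl (min_le_left _ _))
      have hu4 := hu2.trans_le (add_le_add le_rfl (min_le_right _ _))
      have := H u hu (by rw [abs_lt]; constructor <;> linarith)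
      rw [hσ, abs_sub_comm x u, abs_of_pos (sub_pos.2 hu1)] at this
      have h1 := (abs_le.1 this).2
      have : u ≤ x := by
        refine hxm ⟨⟨hu, by linarith [hxP.1.2.1], by linarith⟩, ?_⟩
        have := hxP.2
        nlinarith
      linarith
    · have hpos := lt_of_le_of_ne (le_sigma (T := T) x) (Ne.symm hσ)
      have := (h x hk).sigma_eq hxP.1.1
      have h2 : sigma T x ≤ x := by
        refine hxm ⟨⟨sigma_mem hT hxP.1.1, by linarith [hxP.1.2.1], sigma_le hs hlt⟩, ?_⟩
        have := hxP.2
        nlinarith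
      linarith
  refine le_of_forall_pos_le_add fun η hη => ?_
  have hp : 0 < s - r + 1 := by linarith
  have h1 := key (η / (s - r + 1)) (by positivity)
  have h2 : η / (s - r + 1) * (s - r) ≤ η := by
    rw [div_mul_eq_mul_div, div_le_iff₀ hp]
    nlinarith
  linarith

/-- Comparison of antiderivatives. -/
theorem IsDeltaAntideriv.sub_le_sub (hT : IsClosed T) {F G : ℝ → ℝ} (hF : IsDeltaAntideriv T F f)
    (hG : IsDeltaAntideriv T G g) {r s : ℝ} (hr : r ∈ T) (hs : s ∈ T) (hrs : r ≤ s)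
    (h0 : ∀ x ∈ T, r ≤ x → x < s → f x ≤ g x) : F s - F r ≤ G s - G r := by
  have : IsDeltaAntideriv T (fun x => G x - F x) (fun x => g x - f x) :=
    fun t ht => (hG t ht).sub (hF t ht) ht.1
  have := this.le_of_nonneg hT hr hs hrs fun x hx h1 h2 => sub_nonneg.2 (h0 x hx h1 h2)
  linarith

end TimeScale

namespace TimeScale

open MeasureTheory

variable {T : Set ℝ} {a b : ℝ} {f g : ℝ → ℝ}

/-! ### Existence of antiderivatives -/

/-- The largest point of `T` below `x`. -/
noncomputable def lowerPt (T : Set ℝ) (x : ℝ) : ℝ := sSup (T ∩ Set.Iic x)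

theorem lowerPt_mem (h : IsInterval T a b) {x : ℝ} (hx : a ≤ x) : lowerPt T x ∈ T :=
  h.closed.closure_subset (closure_mono Set.inter_subset_left
    (csSup_mem_closure ⟨a, h.left_mem, hx⟩ ⟨x, fun _ hu => hu.2⟩))

theorem lowerPt_le (h : IsInterval T a b) {x : ℝ} (hx : a ≤ x) : lowerPt T x ≤ x :=
  csSup_le ⟨a, h.left_mem, hx⟩ fun _ hu => hu.2

theorem le_lowerPt {t x : ℝ} (ht : t ∈ T) (htx : t ≤ x) : t ≤ lowerPt T x :=
  le_csSup ⟨x, fun _ hu => hu.2⟩ ⟨ht, htx⟩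

/-- Hence g ∘ `lowerPt T` extends g by constants across the gaps of T. -/
theorem lowerPt_eq (h : IsInterval T a b) {t x : ℝ} (ht : t ∈ T) (htx : t ≤ x)
    (hx : x < sigma T t) : lowerPt T x = t := by
  refine le_antisymm (not_lt.1 fun hlt => ?_) (le_lowerPt ht htx)
  have hax := (h.subset ht).1.trans htx
  linarith [sigma_le (lowerPt_mem h hax) hlt, lowerPt_le h hax]

theorem monotoneOn_lowerPt (h : IsInterval T a b) : MonotoneOn (lowerPt T) (Set.Icc a b) :=
  fun _ hx _ _ hxy => le_lowerPt (lowerPt_mem h hx.1) ((lowerPt_le h hx.1).trans hxy)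

/-- Bounded integrands that are continuous at right-dense points and measurable as step functions
on `[a,b]`. -/
structure Regular (T : Set ℝ) (a b : ℝ) (g : ℝ → ℝ) : Prop where
  bdd : ∃ M, ∀ t ∈ T, |g t| ≤ M
  cont : ∀ t ∈ T, sigma T t = t → ContinuousWithinAt g T t
  meas : AEMeasurable (fun x => g (lowerPt T x)) (volume.restrict (Set.Icc a b))

theorem Regular.add (hf : Regular T a b f) (hg : Regular T a b g) :
    Regular T a b (fun t => f t + g t) := by
  obtain ⟨M, hM⟩ := hf.bdd
  obtain ⟨N, hN⟩ := hg.bdd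
  exact ⟨⟨M + N, fun t ht => (abs_add_le _ _).trans (add_le_add (hM t ht) (hN t ht))⟩,
    fun t ht h => (hf.cont t ht h).add (hg.cont t ht h), hf.meas.add hg.meas⟩

theorem Regular.mul (hf : Regular T a b f) (hg : Regular T a b g) :
    Regular T a b (fun t => f t * g t) := by
  obtain ⟨M, hM⟩ := hf.bdd
  obtain ⟨N, hN⟩ := hg.bdd
  refine ⟨⟨M * N, fun t ht => ?_⟩,
    fun t ht h => (hf.cont t ht h).mul (hg.cont t ht h), hf.meas.mul hg.meas⟩
  rw [abs_mul]
  exact mul_le_mul (hM t ht) (hN t ht) (abs_nonneg _) ((abs_nonneg _).trans (hM t ht))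

theorem IsInterval.isCompact (h : IsInterval T a b) : IsCompact T :=
  isCompact_Icc.of_isClosed_subset h.closed h.subset

theorem exists_bound (h : IsInterval T a b) (hf : ContinuousOn f T) :
    ∃ M, 0 < M ∧ ∀ t ∈ T, |f t| ≤ M := by
  obtain ⟨M, hM⟩ := h.isCompact.exists_bound_of_continuousOn hf
  exact ⟨max M 1, by positivity, fun t ht => (hM t ht).trans (le_max_left _ _)⟩

/-- Tietze extends f to a continuous function on the line, and a monotone map is measurable. -/
theorem aemeasurable_comp_monotoneOn (h : IsInterval T a b) (hf : ContinuousOn f T) {p : ℝ → ℝ}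
    (hp : MonotoneOn p (Set.Icc a b)) (hpT : ∀ x ∈ Set.Icc a b, p x ∈ T) :
    AEMeasurable (fun x => f (p x)) (volume.restrict (Set.Icc a b)) := by
  obtain ⟨F, hF⟩ := ContinuousMap.exists_restrict_eq h.closed ⟨T.domRestrict f, hf.domRestrict⟩
  have h1 : AEMeasurable (fun x => F (p x)) (volume.restrict (Set.Icc a b)) :=
    F.continuous.measurable.comp_aemeasurable
      (aemeasurable_restrict_of_monotoneOn measurableSet_Icc hp)
  refine h1.congr ?_
  filter_upwards [ae_restrict_mem measurableSet_Icc] with x hx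
  exact DFunLike.congr_fun hF ⟨p x, hpT x hx⟩

theorem regular_of_continuousOn (h : IsInterval T a b) (hf : ContinuousOn f T) :
    Regular T a b f := by
  obtain ⟨M, -, hM⟩ := exists_bound h hf
  exact ⟨⟨M, hM⟩, fun t ht _ => hf t ht,
    aemeasurable_comp_monotoneOn h hf (monotoneOn_lowerPt h) fun x hx => lowerPt_mem h hx.1⟩

theorem regular_comp_sigma (h : IsInterval T a b) (hf : ContinuousOn f T) :
    Regular T a b (fun t => f (sigma T t)) := by
  obtain ⟨M, -, hM⟩ := exists_bound h hf
  refine ⟨⟨M, fun t ht => hM _ (sigma_mem h.closed ht)⟩, fun t ht hσ => ?_, ?_⟩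
  · have h1 : ContinuousWithinAt f T (sigma T t) := hf _ (sigma_mem h.closed ht)
    exact h1.comp (continuousWithinAt_sigma ht hσ) fun x hx => sigma_mem h.closed hx
  · refine aemeasurable_comp_monotoneOn h hf (p := fun x => sigma T (lowerPt T x)) ?_
      fun x hx => sigma_mem h.closed (lowerPt_mem h hx.1)
    intro x hx y hy hxy
    exact sigma_mono (lowerPt_mem h hy.1) (monotoneOn_lowerPt h hx hy hxy)

/-- The antiderivative is the Lebesgue integral from a of the extension of g that is constant on
each gap [t, σ(t)). -/
theorem Regular.exists_antideriv (h : IsInterval T a b) (hg : Regular T a b g) :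
    ∃ F, IsDeltaAntideriv T F g := by
  obtain ⟨M₀, hM₀⟩ := hg.bdd
  obtain ⟨M, hMpos, hM⟩ : ∃ M, 0 < M ∧ ∀ t ∈ T, |g t| ≤ M :=
    ⟨max M₀ 1, by positivity, fun t ht => (hM₀ t ht).trans (le_max_left _ _)⟩
  set G : ℝ → ℝ := fun x => g (lowerPt T x) with hG
  have hint : IntegrableOn G (Set.Icc a b) :=
    Integrable.of_bound hg.meas.aestronglyMeasurable M (by
      filter_upwards [ae_restrict_mem measurableSet_Icc] with x hx
      exact hM _ (lowerPt_mem h hx.1))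
  have hii : ∀ x ∈ T, ∀ y ∈ T, IntervalIntegrable G volume x y := fun x hx y hy =>
    (hint.mono_set (Set.uIcc_subset_Icc (h.subset hx) (h.subset hy))).intervalIntegrable
  refine ⟨fun t => ∫ x in a..t, G x, fun t ht => ?_⟩
  have htT := ht.1
  have hat := (h.subset htT).1
  -- The gap [t, σ(t)) contributes exactly g(t)(σ(t) - t), so the error in the definition of the
  -- derivative is an integral between s and t only.
  have hdiff : ∀ s ∈ T, (∫ x in a..sigma T t, G x) - (∫ x in a..s, G x)
      - g t * (sigma T t - s) = ∫ x in s..t, (G x - g t) := by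
    intro s hs
    have hσT := sigma_mem h.closed htT
    rw [intervalIntegral.integral_interval_sub_left (hii a h.left_mem _ hσT)
      (hii a h.left_mem s hs), ← intervalIntegral.integral_add_adjacent_intervals
      (hii s hs t htT) (hii t htT _ hσT)]
    have h1 : ∫ x in t..sigma T t, G x = g t * (sigma T t - t) := by
      rw [intervalIntegral.integral_congr_ae (g := fun _ => g t)]
      · rw [intervalIntegral.integral_const, smul_eq_mul, mul_comm]
      · have : ∀ᵐ x : ℝ, x ≠ sigma T t := by
          simp [ae_iff]
        filter_upwards [this] with x hx hx'
        rw [Set.uIoc_of_le (le_sigma t)] at hx'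
        simp only [hG, lowerPt_eq h htT hx'.1.le (lt_of_le_of_ne hx'.2 hx)]
    rw [h1, intervalIntegral.integral_sub (hii s hs t htT) intervalIntegrable_const,
      intervalIntegral.integral_const, smul_eq_mul]
    ring
  intro ε hε
  by_cases hσ : sigma T t = t
  · obtain ⟨δ, hδ, H⟩ := Metric.continuousWithinAt_iff.1 (hg.cont t htT hσ) ε hε
    refine ⟨δ, hδ, fun s hs hst => ?_⟩
    rw [hdiff s hs, hσ]
    rw [← Real.norm_eq_abs (∫ x in s..t, (G x - g t))]
    refine intervalIntegral.norm_integral_le_of_norm_le_const fun x hx => ?_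
    have hst' := abs_lt.1 hst
    have hx' : min s t < x ∧ x ≤ max s t := hx
    have hax : a ≤ x := (le_min (h.subset hs).1 hat).trans hx'.1.le
    refine (H (lowerPt_mem h hax) ?_).le
    have h1 : lowerPt T x ≤ max s t := (lowerPt_le h hax).trans hx'.2
    have h2 : min s t ≤ lowerPt T x := by
      rcases min_choice s t with hm | hm <;> rw [hm] at hx' ⊢
      · exact le_lowerPt hs hx'.1.le
      · exact le_lowerPt htT hx'.1.le
    have h3 : max s t < t + δ := max_lt (by linarith) (by linarith)
    have h4 : t - δ < min s t := lt_min (by linarith) (by linarith)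
    rw [Real.dist_eq, abs_lt]
    constructor <;> linarith
  · have hpos : 0 < sigma T t - t := by
      have := lt_of_le_of_ne (le_sigma (T := T) t) (Ne.symm hσ); linarith
    -- At a right-scattered point boundedness of g suffices, since |σ(t) - s| ≥ μ for the nearby s,
    -- which all lie at or to the left of t.
    set μ := sigma T t - t with hμ
    refine ⟨min μ (ε * μ / (2 * M)), by positivity, fun s hs hst => ?_⟩
    rw [hdiff s hs]
    have hst' := abs_lt.1 (hst.trans_le (min_le_left _ _))
    have hst2 := hst.trans_le (min_le_right _ _)
    have hle : s ≤ t := not_lt.1 fun hlt => by linarith [sigma_le hs hlt]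
    have h1 : |∫ x in s..t, (G x - g t)| ≤ 2 * M * |t - s| := by
      rw [← Real.norm_eq_abs]
      refine intervalIntegral.norm_integral_le_of_norm_le_const fun x hx => ?_
      rw [Set.uIoc_of_le hle] at hx
      have hax : a ≤ x := (h.subset hs).1.trans hx.1.le
      have e1 := hM _ (lowerPt_mem h hax)
      have e2 := hM t htT
      have := abs_sub (G x) (g t)
      rw [Real.norm_eq_abs]
      simp only [hG] at *
      linarith
    calc _ ≤ 2 * M * |t - s| := h1
      _ ≤ 2 * M * (ε * μ / (2 * M)) := by
        rw [abs_sub_comm]; gcongr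
      _ = ε * μ := by field_simp
      _ ≤ ε * |sigma T t - s| := by
        gcongr
        rw [le_abs]; left; linarith

/-- `t ↦ ∫_a^t g Δ` is an antiderivative of `g`. -/
theorem Regular.isDeltaAntideriv (h : IsInterval T a b) (hg : Regular T a b g) :
    IsDeltaAntideriv T (fun t => deltaIntegral T g a t) g := by
  obtain ⟨F, hF⟩ := hg.exists_antideriv h
  intro t ht
  have h1 := (hF t ht).sub (hasDeltaDerivAt_const (F a) ht.1) ht.1
  rw [sub_zero] at h1
  exact h1.congr h.closed ht.1 fun s hs =>
    deltaIntegral_eq h.closed hF h.left_mem hs (h.subset hs).1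

theorem deltaIntegral_self (g : ℝ → ℝ) : deltaIntegral T g a a = 0 := by
  unfold deltaIntegral
  split_ifs <;> simp

theorem Regular.continuousOn_deltaIntegral (h : IsInterval T a b) (hg : Regular T a b g) :
    ContinuousOn (fun t => deltaIntegral T g a t) T :=
  (hg.isDeltaAntideriv h).continuousOn

theorem Regular.const_mul (h : IsInterval T a b) (c : ℝ) (hg : Regular T a b g) :
    Regular T a b (fun t => c * g t) :=
  (regular_of_continuousOn h continuousOn_const).mul hg

theorem deltaIntegral_add (h : IsInterval T a b) (hf : Regular T a b f) (hg : Regular T a b g)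
    {t : ℝ} (ht : t ∈ T) : deltaIntegral T (fun x => f x + g x) a t =
      deltaIntegral T f a t + deltaIntegral T g a t := by
  have : IsDeltaAntideriv T (fun t => deltaIntegral T f a t + deltaIntegral T g a t)
      (fun x => f x + g x) := fun s hs =>
    (hf.isDeltaAntideriv h s hs).add (hg.isDeltaAntideriv h s hs) hs.1
  rw [deltaIntegral_eq h.closed this h.left_mem ht (h.subset ht).1]
  simp [deltaIntegral_self]

theorem deltaIntegral_const_mul (h : IsInterval T a b) (c : ℝ) (hg : Regular T a b g)
    {t : ℝ} (ht : t ∈ T) : deltaIntegral T (fun x => c * g x) a t =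
      c * deltaIntegral T g a t := by
  have : IsDeltaAntideriv T (fun t => c * deltaIntegral T g a t)
      (fun x => c * g x) := fun s hs => (hg.isDeltaAntideriv h s hs).const_mul c hs.1
  rw [deltaIntegral_eq h.closed this h.left_mem ht (h.subset ht).1]
  simp [deltaIntegral_self]

theorem deltaIntegral_congr (h : IsInterval T a b) (hg : Regular T a b g)
    (hfg : ∀ x ∈ kappa T, f x = g x) {t : ℝ} (ht : t ∈ T) :
    deltaIntegral T f a t = deltaIntegral T g a t := by
  have : IsDeltaAntideriv T (fun t => deltaIntegral T g a t) f := fun s hs => by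
    rw [hfg s hs]; exact hg.isDeltaAntideriv h s hs
  rw [deltaIntegral_eq h.closed this h.left_mem ht (h.subset ht).1]
  simp [deltaIntegral_self]

/-- If `|g| ≤ φ` below `t` and `Φ^Δ ≥ φ`, then `|∫_a^t g Δ| ≤ Φ(t) - Φ(a)`. -/
theorem abs_deltaIntegral_le (h : IsInterval T a b) (hg : Regular T a b g) {Φ φ : ℝ → ℝ}
    (hΦ : IsDeltaAntideriv T Φ φ) {t : ℝ} (ht : t ∈ T)
    (hle : ∀ x ∈ T, x < t → |g x| ≤ φ x) :
    |deltaIntegral T g a t| ≤ Φ t - Φ a := by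
  have hat := (h.subset ht).1
  have h1 := (hg.isDeltaAntideriv h).sub_le_sub h.closed hΦ h.left_mem ht hat
    fun x hx _ hxt => (le_abs_self _).trans (hle x hx hxt)
  have hn : IsDeltaAntideriv T (fun t => -1 * Φ t) (fun t => -1 * φ t) :=
    fun s hs => (hΦ s hs).const_mul (-1) hs.1
  have h2 := hn.sub_le_sub h.closed (hg.isDeltaAntideriv h) h.left_mem ht hat
    fun x hx _ hxt => by linarith [(neg_abs_le (g x)), hle x hx hxt]
  simp only [deltaIntegral_self] at h1 h2
  rw [abs_le]
  constructor <;> linarith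

end TimeScale

namespace TimeScale

open MeasureTheory

variable {T : Set ℝ} {a b : ℝ} {f g : ℝ → ℝ}

/-! ### Integral operators on `C(T)` -/

/-- Extension of a function on `T` to the real line. -/
noncomputable def extendZero (φ : C(T, ℝ)) : ℝ → ℝ := Function.extend Subtype.val φ 0

theorem extendZero_apply (φ : C(T, ℝ)) {t : ℝ} (ht : t ∈ T) : extendZero φ t = φ ⟨t, ht⟩ :=
  Subtype.val_injective.extend_apply φ 0 ⟨t, ht⟩

theorem continuousOn_extendZero (φ : C(T, ℝ)) : ContinuousOn (extendZero φ) T := by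
  rw [continuousOn_iff_continuous_domRestrict]
  convert φ.continuous using 1
  ext t
  exact extendZero_apply φ t.2

theorem regular_mul_comp_sigma (h : IsInterval T a b) {r : ℝ → ℝ} (hr : ContinuousOn r T)
    (hf : ContinuousOn f T) : Regular T a b (fun t => r t * f (sigma T t)) :=
  (regular_of_continuousOn h hr).mul (regular_comp_sigma h hf)

theorem isDeltaAntideriv_mul_id (c : ℝ) : IsDeltaAntideriv T (fun x => c * x) (fun _ => c) :=
  fun t ht => by simpa using (hasDeltaDerivAt_id ht.1).const_mul c ht.1

theorem abs_deltaIntegral_le_const (h : IsInterval T a b) (hg : Regular T a b g) {c : ℝ} {t : ℝ}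
    (ht : t ∈ T) (hle : ∀ x ∈ T, x < t → |g x| ≤ c) :
    |deltaIntegral T g a t| ≤ c * (t - a) := by
  have := abs_deltaIntegral_le h hg (isDeltaAntideriv_mul_id c) ht hle
  linarith

theorem deltaIntegral_nonpos (h : IsInterval T a b) (hg : Regular T a b g) {t : ℝ}
    (ht : t ∈ T) (hle : ∀ x ∈ T, g x ≤ 0) : deltaIntegral T g a t ≤ 0 := by
  have := (hg.isDeltaAntideriv h).sub_le_sub h.closed (isDeltaAntideriv_mul_id 0) h.left_mem ht
    (h.subset ht).1 fun x hx _ _ => hle x hx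
  simp only [deltaIntegral_self] at this
  linarith

/-- Substitute for the power rule: the product rule brings in powers of σ(t) - a, and σ(t) ≥ t gives
the inequality in the direction needed to bound iterated integrals by (t - a)^n / n!. -/
theorem exists_hasDeltaDerivAt_pow (h : IsInterval T a b) (n : ℕ) {t : ℝ} (ht : t ∈ T) :
    ∃ d, (n + 1) * (t - a) ^ n ≤ d ∧ HasDeltaDerivAt T (fun x => (x - a) ^ (n + 1)) d t := by
  have h1 : HasDeltaDerivAt T (fun x => x - a) 1 t := by
    simpa using (hasDeltaDerivAt_id ht).sub (hasDeltaDerivAt_const a ht) ht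
  have hat := sub_nonneg.2 (h.subset ht).1
  induction n with
  | zero => exact ⟨1, by simp, by simpa using h1⟩
  | succ n ih =>
    obtain ⟨d, hd, H⟩ := ih
    refine ⟨d * (t - a) + (sigma T t - a) ^ (n + 1) * 1, ?_, ?_⟩
    · have h2 : (t - a) ^ (n + 1) ≤ (sigma T t - a) ^ (n + 1) := by
        have := le_sigma (T := T) t
        gcongr
      have h3 := mul_le_mul_of_nonneg_right hd hat
      push_cast
      have h4 : (n + 1 : ℝ) * (t - a) ^ n * (t - a) = (n + 1) * (t - a) ^ (n + 1) := by ring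
      linarith
    · exact H.mul h1 ht

variable [CompactSpace T]

theorem abs_extendZero_le (φ : C(T, ℝ)) {t : ℝ} (ht : t ∈ T) : |extendZero φ t| ≤ ‖φ‖ := by
  rw [extendZero_apply φ ht]
  exact φ.norm_coe_le_norm _

/-- The operator `φ ↦ ∫_a^t r φ^σ Δ` on `C(T)`. -/
noncomputable def sigmaIntegralOp (h : IsInterval T a b) {r : ℝ → ℝ} (hr : ContinuousOn r T) :
    C(T, ℝ) →L[ℝ] C(T, ℝ) :=
  LinearMap.mkContinuous
    { toFun := fun φ => ⟨T.domRestrict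
        (fun t => deltaIntegral T (fun s => r s * extendZero φ (sigma T s)) a t),
        ((regular_mul_comp_sigma h hr (continuousOn_extendZero φ)).continuousOn_deltaIntegral
          h).domRestrict⟩
      map_add' := fun φ ψ => by
        ext t
        simp only [ContinuousMap.coe_mk, Set.domRestrict_apply, ContinuousMap.add_apply]
        rw [← deltaIntegral_add h (regular_mul_comp_sigma h hr (continuousOn_extendZero φ))
          (regular_mul_comp_sigma h hr (continuousOn_extendZero ψ)) t.2]
        refine deltaIntegral_congr h ((regular_mul_comp_sigma h hr
          (continuousOn_extendZero φ)).add (regular_mul_comp_sigma h hr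
          (continuousOn_extendZero ψ))) (fun x hx => ?_) t.2
        simp only [extendZero_apply _ (sigma_mem h.closed hx.1), ContinuousMap.add_apply]
        ring
      map_smul' := fun c φ => by
        ext t
        simp only [ContinuousMap.coe_mk, Set.domRestrict_apply, ContinuousMap.smul_apply,
          RingHom.id_apply, smul_eq_mul]
        rw [← deltaIntegral_const_mul h c
          (regular_mul_comp_sigma h hr (continuousOn_extendZero φ)) t.2]
        refine deltaIntegral_congr h ((regular_mul_comp_sigma h hr
          (continuousOn_extendZero φ)).const_mul h c) (fun x hx => ?_) t.2
        simp only [extendZero_apply _ (sigma_mem h.closed hx.1), ContinuousMap.smul_apply,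
          smul_eq_mul]
        ring }
    ((exists_bound h hr).choose * (b - a)) (fun φ => by
      obtain ⟨hM0, hM⟩ := (exists_bound h hr).choose_spec
      set M := (exists_bound h hr).choose
      have hab := h.lt
      rw [ContinuousMap.norm_le _ (by have := sub_pos.2 hab; positivity)]
      intro t
      refine (abs_deltaIntegral_le_const h (c := M * ‖φ‖) (regular_mul_comp_sigma h hr
        (continuousOn_extendZero φ)) t.2 fun x hx hxt => ?_).trans ?_
      · rw [abs_mul]
        exact mul_le_mul (hM x hx) (abs_extendZero_le φ (sigma_mem h.closed hx)) (abs_nonneg _)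
          hM0.le
      · have := (h.subset t.2).2
        rw [mul_right_comm]
        gcongr)

theorem sigmaIntegralOp_apply (h : IsInterval T a b) {r : ℝ → ℝ} (hr : ContinuousOn r T)
    (φ : C(T, ℝ)) (t : T) : sigmaIntegralOp h hr φ t =
      deltaIntegral T (fun s => r s * extendZero φ (sigma T s)) a t := rfl

/-- The operator `φ ↦ ∫_a^t φ Δ` on `C(T)`. -/
noncomputable def integralOp (h : IsInterval T a b) : C(T, ℝ) →L[ℝ] C(T, ℝ) :=
  LinearMap.mkContinuous
    { toFun := fun φ => ⟨T.domRestrict (fun t => deltaIntegral T (extendZero φ) a t),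
        ((regular_of_continuousOn h (continuousOn_extendZero φ)).continuousOn_deltaIntegral
          h).domRestrict⟩
      map_add' := fun φ ψ => by
        ext t
        simp only [ContinuousMap.coe_mk, Set.domRestrict_apply, ContinuousMap.add_apply]
        rw [← deltaIntegral_add h (regular_of_continuousOn h (continuousOn_extendZero φ))
          (regular_of_continuousOn h (continuousOn_extendZero ψ)) t.2]
        refine deltaIntegral_congr h ((regular_of_continuousOn h
          (continuousOn_extendZero φ)).add (regular_of_continuousOn h
          (continuousOn_extendZero ψ))) (fun x hx => ?_) t.2
        simp only [extendZero_apply _ hx.1, ContinuousMap.add_apply]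
      map_smul' := fun c φ => by
        ext t
        simp only [ContinuousMap.coe_mk, Set.domRestrict_apply, ContinuousMap.smul_apply,
          RingHom.id_apply, smul_eq_mul]
        rw [← deltaIntegral_const_mul h c
          (regular_of_continuousOn h (continuousOn_extendZero φ)) t.2]
        refine deltaIntegral_congr h ((regular_of_continuousOn h
          (continuousOn_extendZero φ)).const_mul h c) (fun x hx => ?_) t.2
        simp only [extendZero_apply _ hx.1, ContinuousMap.smul_apply, smul_eq_mul] }
    (b - a) (fun φ => by
      have hab := sub_pos.2 h.lt
      rw [ContinuousMap.norm_le _ (by positivity)]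
      intro t
      refine (abs_deltaIntegral_le_const h (c := ‖φ‖) (regular_of_continuousOn h
        (continuousOn_extendZero φ)) t.2 fun x hx _ => abs_extendZero_le φ hx).trans ?_
      have := (h.subset t.2).2
      rw [mul_comm]
      gcongr)

theorem integralOp_apply (h : IsInterval T a b) (φ : C(T, ℝ)) (t : T) :
    integralOp h φ t = deltaIntegral T (extendZero φ) a t := rfl

/-- The Volterra operator `φ ↦ ∫_a^t ∫_a^x r φ^σ Δ Δ`. -/
noncomputable def volterraOp (h : IsInterval T a b) {r : ℝ → ℝ} (hr : ContinuousOn r T) :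
    C(T, ℝ) →L[ℝ] C(T, ℝ) := integralOp h ∘L sigmaIntegralOp h hr

/-- For x < s in T one has σ(x) ≤ s, so the bound at s controls the inner integrand, and the inner
integral costs only a factor b - a. The outer integral, which involves no σ, raises the power and
produces the factorial. -/
theorem abs_volterraOp_le (h : IsInterval T a b) {r : ℝ → ℝ} (hr : ContinuousOn r T) {M C : ℝ}
    (hM : ∀ t ∈ T, |r t| ≤ M) (hM0 : 0 ≤ M) (hC : 0 ≤ C) (n : ℕ) (φ : C(T, ℝ))
    (hφ : ∀ t : T, |φ t| ≤ C * ((t - a) ^ n / n.factorial)) (t : T) :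
    |volterraOp h hr φ t| ≤ C * (M * (b - a)) * ((t - a) ^ (n + 1) / (n + 1).factorial) := by
  have hab := (sub_pos.2 h.lt).le
  have inner : ∀ s : T, |sigmaIntegralOp h hr φ s| ≤
      C * (M * (b - a)) * ((s - a) ^ n / n.factorial) := by
    intro s
    have has := sub_nonneg.2 (h.subset s.2).1
    refine (abs_deltaIntegral_le_const h (c := M * (C * ((s - a) ^ n / n.factorial)))
      (regular_mul_comp_sigma h hr (continuousOn_extendZero φ)) s.2 fun x hx hxt => ?_).trans ?_
    · have hσ := sigma_mem h.closed hx
      have haσ := sub_nonneg.2 (h.subset hσ).1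
      have hσs := sigma_le s.2 hxt
      rw [abs_mul]
      refine mul_le_mul (hM x hx) ?_ (abs_nonneg _) hM0
      rw [extendZero_apply _ hσ]
      refine (hφ ⟨_, hσ⟩).trans ?_
      simp only
      gcongr
    · have := (h.subset s.2).2
      calc _ ≤ M * (C * ((s - a) ^ n / n.factorial)) * (b - a) := by gcongr
        _ = _ := by ring
  choose! d hd H using fun (t : ℝ) (ht : t ∈ T) => exists_hasDeltaDerivAt_pow h n ht
  set K := C * (M * (b - a)) with hK
  have hK0 : 0 ≤ K := by positivity
  have hfac : ((n + 1).factorial : ℝ) = (n + 1) * n.factorial := by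
    rw [Nat.factorial_succ]; push_cast; ring
  have hf0 : (0 : ℝ) < n.factorial := by exact_mod_cast n.factorial_pos
  have hΦ : IsDeltaAntideriv T (fun x => K / (n + 1).factorial * (x - a) ^ (n + 1))
      (fun x => K / (n + 1).factorial * d x) := fun x hx => (H x hx.1).const_mul _ hx.1
  have := abs_deltaIntegral_le h (regular_of_continuousOn h
    (continuousOn_extendZero (sigmaIntegralOp h hr φ))) hΦ t.2 fun x hx _ => by
      rw [extendZero_apply _ hx]
      refine (inner ⟨x, hx⟩).trans ?_
      calc K * ((x - a) ^ n / n.factorial)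
          = K / (n + 1).factorial * ((n + 1) * (x - a) ^ n) := by
            rw [hfac]; field_simp
        _ ≤ K / (n + 1).factorial * d x := by gcongr; exact hd x hx
  refine this.trans (le_of_eq ?_)
  simp
  ring

/-- Iterating the previous estimate gives ‖K^n‖ ≤ (M (b - a)²)^n / n! with no smallness assumption
on r. -/
theorem tendsto_volterraOp_pow (h : IsInterval T a b) {r : ℝ → ℝ} (hr : ContinuousOn r T) :
    Tendsto (fun n => ‖volterraOp h hr ^ n‖) atTop (𝓝 0) := by
  obtain ⟨M, hM0, hM⟩ := exists_bound h hr
  have hab := sub_pos.2 h.lt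
  have key : ∀ (n : ℕ) (φ : C(T, ℝ)) (t : T), |(volterraOp h hr ^ n) φ t| ≤
      ‖φ‖ * (M * (b - a)) ^ n * ((t - a) ^ n / n.factorial) := by
    intro n φ
    induction n with
    | zero => intro t; simpa using φ.norm_coe_le_norm t
    | succ n ih =>
      intro t
      rw [pow_succ', mul_apply_eq_comp]
      refine (abs_volterraOp_le h hr hM hM0.le (by positivity) n _ ih t).trans (le_of_eq ?_)
      ring
  refine squeeze_zero (fun n => norm_nonneg (volterraOp h hr ^ n)) (fun n => ?_)
    (FloorSemiring.tendsto_pow_div_factorial_atTop (M * (b - a) * (b - a)))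
  refine ContinuousLinearMap.opNorm_le_bound _ (by positivity) fun φ => ?_
  rw [ContinuousMap.norm_le _ (by positivity)]
  intro t
  refine (key n φ t).trans ?_
  have h1 := sub_nonneg.2 (h.subset t.2).1
  have h2 := (h.subset t.2).2
  calc _ ≤ ‖φ‖ * (M * (b - a)) ^ n * ((b - a) ^ n / n.factorial) := by gcongr
    _ = _ := by rw [mul_pow (M * (b - a))]; ring

/-! ### Inverting `1 + x`, and positivity of solutions of the Volterra equation -/

theorem norm_neg_pow {A : Type*} [NormedRing A] (x : A) (n : ℕ) : ‖(-x) ^ n‖ = ‖x ^ n‖ := by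
  rw [neg_pow]
  rcases neg_one_pow_eq_or A n with h | h <;> simp [h]

/-- Some power has norm below 1, so 1 - (-x)^n is invertible; 1 + x is a factor of it, commuting
with the cofactor. -/
theorem isUnit_one_add_of_tendsto_pow {A : Type*} [NormedRing A] [CompleteSpace A] {x : A}
    (hx : Tendsto (fun n => ‖x ^ n‖) atTop (𝓝 0)) : IsUnit (1 + x) := by
  obtain ⟨n, hn⟩ := (hx.eventually (gt_mem_nhds one_pos)).exists
  have h1 : IsUnit (1 - (-x) ^ n) := isUnit_one_sub_of_norm_lt_one (by rwa [norm_neg_pow])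
  have h2 : Commute (1 - -x) (∑ i ∈ Finset.range n, (-x) ^ i) :=
    ((Commute.one_left _).sub_left (Commute.sum_right _ _ _ fun i _ => Commute.self_pow _ _))
  rw [← mul_neg_geom_sum (-x) n, h2.isUnit_mul_iff, sub_neg_eq_add] at h1
  exact h1.1

theorem sigmaIntegralOp_add_const (h : IsInterval T a b) {q : ℝ → ℝ} (hq : ContinuousOn q T)
    (l : ℝ) : sigmaIntegralOp h (r := fun t => q t + l) (hq.add continuousOn_const) =
      sigmaIntegralOp h hq + l • sigmaIntegralOp h (continuousOn_const (c := (1 : ℝ))) := by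
  ext φ t
  simp only [_root_.add_apply, _root_.smul_apply,
    ContinuousMap.add_apply, ContinuousMap.smul_apply, smul_eq_mul, sigmaIntegralOp_apply]
  have h1 := regular_mul_comp_sigma h hq (continuousOn_extendZero φ)
  have h2 := regular_mul_comp_sigma h (continuousOn_const (c := (1 : ℝ)))
    (continuousOn_extendZero φ)
  rw [← deltaIntegral_const_mul h l h2 t.2, ← deltaIntegral_add h h1 (h2.const_mul h l) t.2]
  refine deltaIntegral_congr h (h1.add (h2.const_mul h l)) (fun x hx => ?_) t.2
  ring

theorem volterraOp_add_const (h : IsInterval T a b) {q : ℝ → ℝ} (hq : ContinuousOn q T)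
    (l : ℝ) : volterraOp h (r := fun t => q t + l) (hq.add continuousOn_const) =
      volterraOp h hq + l • volterraOp h (continuousOn_const (c := (1 : ℝ))) := by
  rw [volterraOp, sigmaIntegralOp_add_const, ContinuousLinearMap.comp_add,
    ContinuousLinearMap.comp_smul]
  rfl

theorem volterraOp_nonpos (h : IsInterval T a b) {r : ℝ → ℝ} (hr : ContinuousOn r T)
    (hr0 : ∀ t ∈ T, r t ≤ 0) {φ : C(T, ℝ)} (hφ : ∀ t, 0 ≤ φ t) (t : T) :
    volterraOp h hr φ t ≤ 0 := by
  refine deltaIntegral_nonpos h (regular_of_continuousOn h (continuousOn_extendZero _)) t.2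
    fun s hs => ?_
  rw [extendZero_apply _ hs]
  refine deltaIntegral_nonpos h (regular_mul_comp_sigma h hr (continuousOn_extendZero φ)) hs
    fun x hx => ?_
  rw [extendZero_apply _ (sigma_mem h.closed hx)]
  exact mul_nonpos_of_nonpos_of_nonneg (hr0 x hx) (hφ _)

/-- P = -K preserves nonnegativity and φ = ψ + Pφ. Induction gives φ - P^{n+1} φ ≥ ψ without knowing
the sign of φ beforehand, and P^{n+1} φ tends to 0. -/
theorem le_of_add_volterraOp_eq (h : IsInterval T a b) {r : ℝ → ℝ} (hr : ContinuousOn r T)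
    (hr0 : ∀ t ∈ T, r t ≤ 0) {φ ψ : C(T, ℝ)} (hψ : ∀ t, 0 ≤ ψ t)
    (hφ : φ + volterraOp h hr φ = ψ) (t : T) : ψ t ≤ φ t := by
  set P := -volterraOp h hr with hP
  have hPφ : φ = ψ + P φ := by
    rw [← hφ, hP, _root_.neg_apply]; abel
  have key : ∀ (n : ℕ) (t : T), ψ t ≤ φ t - (P ^ (n + 1)) φ t := by
    intro n
    induction n with
    | zero =>
      intro t
      rw [zero_add, pow_one]
      have := DFunLike.congr_fun hPφ t
      rw [ContinuousMap.add_apply] at this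
      linarith
    | succ n ih =>
      intro t
      have h1 := DFunLike.congr_fun hPφ t
      rw [ContinuousMap.add_apply] at h1
      have h2 : volterraOp h hr (φ - (P ^ (n + 1)) φ) t ≤ 0 :=
        volterraOp_nonpos h hr hr0 (fun s => (hψ s).trans (ih s)) t
      have h3 : P (φ - (P ^ (n + 1)) φ) t = P φ t - (P ^ (n + 1 + 1)) φ t := by
        rw [map_sub, pow_succ' P (n + 1), mul_apply_eq_comp]; rfl
      have h4 : P (φ - (P ^ (n + 1)) φ) t = -volterraOp h hr (φ - (P ^ (n + 1)) φ) t := rfl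
      linarith
  have hlim : Tendsto (fun n => φ t - (P ^ (n + 1)) φ t) atTop (𝓝 (φ t - 0)) := by
    refine tendsto_const_nhds.sub (squeeze_zero_norm (a := fun n =>
      ‖volterraOp h hr ^ (n + 1)‖ * ‖φ‖) (fun n => ?_) ?_)
    · refine (((P ^ (n + 1)) φ).norm_coe_le_norm t).trans ?_
      refine ((P ^ (n + 1)).le_opNorm φ).trans (le_of_eq ?_)
      congr 1
      exact norm_neg_pow (volterraOp h hr) (n + 1)
    · simpa using ((tendsto_volterraOp_pow h hr).comp (tendsto_add_atTop_nat 1)).mul_const ‖φ‖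
  rw [sub_zero] at hlim
  exact ge_of_tendsto' hlim fun n => key n t

end TimeScale

namespace TimeScale

variable {T : Set ℝ} {a b : ℝ}

/-! ### The initial value problem -/

/-- Solutions of `u^Δ = v`, `v^Δ = -r u^σ`. -/
structure IsSolution (T : Set ℝ) (r u v : ℝ → ℝ) : Prop where
  du : IsDeltaAntideriv T u v
  dv : IsDeltaAntideriv T v (fun t => -(r t * u (sigma T t)))

theorem isUnit_one_add_continuousLinearMap {E : Type*} [NormedAddCommGroup E] [NormedSpace ℝ E]
    [CompleteSpace E] {K : E →L[ℝ] E} (hK : Tendsto (fun n => ‖K ^ n‖) atTop (𝓝 0)) :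
    IsUnit (1 + K) := isUnit_one_add_of_tendsto_pow hK

theorem isUnit_one_add_volterraOp [CompactSpace T] (h : IsInterval T a b) {r : ℝ → ℝ}
    (hr : ContinuousOn r T) : IsUnit (1 + volterraOp h hr) :=
  isUnit_one_add_continuousLinearMap (tendsto_volterraOp_pow h hr)

/-- Inversion is continuous at units of the Banach algebra of operators. -/
theorem exists_continuous_family {E : Type*} [NormedAddCommGroup E] [NormedSpace ℝ E]
    [CompleteSpace E] (K K₁ : E →L[ℝ] E) (hunit : ∀ l : ℝ, IsUnit (1 + (K + l • K₁))) (u₀ : E) :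
    ∃ U : ℝ → E, Continuous U ∧ ∀ l, U l + (K + l • K₁) (U l) = u₀ := by
  refine ⟨fun l => Ring.inverse (1 + (K + l • K₁)) u₀, ?_, fun l => ?_⟩
  · refine continuous_iff_continuousAt.2 fun l => ?_
    have h1 : ContinuousAt (fun l : ℝ => Ring.inverse (1 + (K + l • K₁))) l := by
      have h2 : ContinuousAt Ring.inverse (1 + (K + l • K₁)) := by
        obtain ⟨w, hw⟩ := hunit l
        rw [← hw]
        exact NormedRing.inverse_continuousAt w
      exact ContinuousAt.comp (f := fun l : ℝ => 1 + (K + l • K₁)) h2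
        (by fun_prop)
    exact h1.clm_apply continuousAt_const
  · have : ((1 + (K + l • K₁)) * Ring.inverse (1 + (K + l • K₁))) u₀ = u₀ := by
      rw [Ring.mul_inverse_cancel _ (hunit l)]; rfl
    exact this

/-- The solutions of the initial value problem depend continuously on the parameter. -/
theorem exists_solution_family (h : IsInterval T a b) {q : ℝ → ℝ} (hq : ContinuousOn q T)
    (α β : ℝ) : ∃ u v : ℝ → ℝ → ℝ,
      (∀ l, IsSolution T (fun t => q t + l) (u l) (v l) ∧ u l a = α ∧ v l a = β) ∧
      (∀ l₀, ∀ η > 0, ∀ᶠ l in 𝓝 l₀, ∀ t ∈ T, |u l t - u l₀ t| ≤ η ∧ |v l t - v l₀ t| ≤ η) ∧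
      (0 ≤ α → 0 ≤ β → ∀ l, (∀ t ∈ T, q t + l ≤ 0) → ∀ t ∈ T, α + β * (t - a) ≤ u l t) := by
  have : CompactSpace T := isCompact_iff_compactSpace.1 h.isCompact
  have hql : ∀ l, ContinuousOn (fun t => q t + l) T := fun l => hq.add continuousOn_const
  obtain ⟨D, hD₀⟩ : ∃ D, D = sigmaIntegralOp h hq := ⟨_, rfl⟩
  obtain ⟨D₁, hD₁⟩ : ∃ D₁, D₁ = sigmaIntegralOp h (continuousOn_const (c := (1 : ℝ))) := ⟨_, rfl⟩
  obtain ⟨cβ, hcβ⟩ : ∃ cβ : C(T, ℝ), cβ = ContinuousMap.const T β := ⟨_, rfl⟩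
  obtain ⟨u₀, hu₀⟩ : ∃ u₀ : C(T, ℝ), u₀ = ContinuousMap.const T α + integralOp h cβ := ⟨_, rfl⟩
  have hD : ∀ l, sigmaIntegralOp h (hql l) = D + l • D₁ := fun l => by
    rw [hD₀, hD₁]; exact sigmaIntegralOp_add_const h hq l
  have hunit : ∀ l, IsUnit (1 + (volterraOp h hq +
      l • volterraOp h (continuousOn_const (c := (1 : ℝ))))) := fun l =>
    volterraOp_add_const h hq l ▸ isUnit_one_add_volterraOp h (hql l)
  obtain ⟨U, hUc, hU⟩ := exists_continuous_family _ _ hunit u₀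
  have hUeq : ∀ l, U l + volterraOp h (hql l) (U l) = u₀ := fun l => by
    rw [← hU l, volterraOp_add_const h hq l]
  -- The second component is recovered from the first as v = β - ∫ (q + l) u^σ.
  obtain ⟨V, hV⟩ : ∃ V : ℝ → C(T, ℝ), V = fun l => cβ - (D + l • D₁) (U l) := ⟨_, rfl⟩
  have hVc : Continuous V := by
    have : Continuous fun l : ℝ => D + l • D₁ := by fun_prop
    rw [hV]
    exact continuous_const.sub (this.clm_apply hUc)
  have hUV : ∀ l, U l = ContinuousMap.const T α + integralOp h (V l) := fun l => by
    rw [hV, map_sub, ← hD l, ← add_sub_assoc, ← hu₀, ← hUeq l]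
    exact (add_sub_cancel_right _ _).symm
  have hclose : ∀ W : ℝ → C(T, ℝ), Continuous W → ∀ l₀, ∀ η > 0, ∀ᶠ l in 𝓝 l₀,
      ∀ t ∈ T, |extendZero (W l) t - extendZero (W l₀) t| ≤ η := by
    intro W hW l₀ η hη
    filter_upwards [Metric.tendsto_nhds.1 hW.continuousAt η hη] with l hl t ht
    rw [extendZero_apply _ ht, extendZero_apply _ ht]
    exact (ContinuousMap.dist_apply_le_dist ⟨t, ht⟩).trans hl.le
  have hu₀t : ∀ t : T, u₀ t = α + β * (t - a) := fun t => by
    rw [hu₀, ContinuousMap.add_apply, integralOp_apply, deltaIntegral_congr h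
      (regular_of_continuousOn h (continuousOn_const (c := β)))
      (fun x hx => by rw [extendZero_apply _ hx.1, hcβ]; rfl) t.2,
      deltaIntegral_eq h.closed (isDeltaAntideriv_mul_id β) h.left_mem t.2 (h.subset t.2).1,
      ContinuousMap.const_apply]
    ring
  refine ⟨fun l => extendZero (U l), fun l => extendZero (V l), fun l => ⟨⟨?_, ?_⟩, ?_, ?_⟩,
    fun l₀ η hη => ?_, fun hα hβ l hl t ht => ?_⟩
  · intro t ht
    have h1 := ((regular_of_continuousOn h (continuousOn_extendZero (V l))).isDeltaAntideriv h t
      ht).add (hasDeltaDerivAt_const α ht.1) ht.1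
    rw [add_zero] at h1
    refine h1.congr h.closed ht.1 fun s hs => ?_
    beta_reduce
    rw [extendZero_apply _ hs, hUV l, add_comm]
    rfl
  · intro t ht
    have h1 := (hasDeltaDerivAt_const β ht.1).sub ((regular_mul_comp_sigma h (hql l)
      (continuousOn_extendZero (U l))).isDeltaAntideriv h t ht) ht.1
    rw [zero_sub] at h1
    refine h1.congr h.closed ht.1 fun s hs => ?_
    beta_reduce
    rw [extendZero_apply _ hs, hV]
    simp only
    rw [← hD l, hcβ]
    rfl
  · beta_reduce
    rw [extendZero_apply _ h.left_mem, hUV l, ContinuousMap.add_apply, integralOp_apply,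
      deltaIntegral_self]
    simp
  · beta_reduce
    rw [extendZero_apply _ h.left_mem, hV]
    simp only
    rw [← hD l, ContinuousMap.sub_apply, sigmaIntegralOp_apply, deltaIntegral_self]
    simp [hcβ]
  · filter_upwards [hclose U hUc l₀ η hη, hclose V hVc l₀ η hη] with l h1 h2 t ht
    exact ⟨h1 t ht, h2 t ht⟩
  · simp only
    rw [extendZero_apply _ ht, ← hu₀t ⟨t, ht⟩]
    refine le_of_add_volterraOp_eq h (hql l) hl (fun s => ?_) (hUeq l) _
    rw [hu₀t]
    have := sub_nonneg.2 (h.subset s.2).1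
    positivity

end TimeScale

namespace TimeScale

variable {T : Set ℝ} {a b : ℝ} {r u v : ℝ → ℝ}

theorem IsInterval.exists_ne (h : IsInterval T a b) (t : ℝ) : ∃ s ∈ T, s ≠ t := by
  by_cases hta : t = a
  · exact ⟨b, h.right_mem, hta ▸ h.lt.ne'⟩
  · exact ⟨a, h.left_mem, Ne.symm hta⟩

/-! ### The quadratic form -/

theorem IsSolution.continuousOn_left (hs : IsSolution T r u v) : ContinuousOn u T :=
  hs.du.continuousOn

theorem IsSolution.continuousOn_right (hs : IsSolution T r u v) : ContinuousOn v T :=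
  hs.dv.continuousOn

theorem IsSolution.add_const_mul {u' v' : ℝ → ℝ} (hs : IsSolution T r u v)
    (hs' : IsSolution T r u' v') (c : ℝ) :
    IsSolution T r (fun t => u t + c * u' t) (fun t => v t + c * v' t) := by
  refine ⟨fun t ht => (hs.du t ht).add ((hs'.du t ht).const_mul c ht.1) ht.1, fun t ht => ?_⟩
  convert (hs.dv t ht).add ((hs'.dv t ht).const_mul c ht.1) ht.1 using 1
  ring

theorem IsSolution.wronskian_eq (h : IsInterval T a b) {u' v' : ℝ → ℝ} (hs : IsSolution T r u v)
    (hs' : IsSolution T r u' v') {t : ℝ} (ht : t ∈ T) :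
    u t * v' t - u' t * v t = u a * v' a - u' a * v a := by
  have hW : IsDeltaAntideriv T (fun t => u t * v' t - u' t * v t) (fun _ => 0) := by
    intro s hs1
    convert ((hs.du s hs1).mul (hs'.dv s hs1) hs1.1).sub
      ((hs'.du s hs1).mul (hs.dv s hs1) hs1.1) hs1.1 using 1
    ring
  have h0 := isDeltaAntideriv_mul_id (T := T) 0
  have hat := (h.subset ht).1
  have h1 := hW.sub_le_sub h.closed h0 h.left_mem ht hat fun _ _ _ _ => le_rfl
  have h2 := h0.sub_le_sub h.closed hW h.left_mem ht hat fun _ _ _ _ => le_rfl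
  linarith

/-- The quadratic form `∫_a^b [(y^Δ)² - r (y^σ)²] Δt` is nonnegative on the functions vanishing
at `a` and `b`. -/
def IsNonnegForm (T : Set ℝ) (a b : ℝ) (r : ℝ → ℝ) : Prop :=
  ∀ y w H : ℝ → ℝ, IsDeltaAntideriv T y w → y a = 0 → y b = 0 →
    IsDeltaAntideriv T H (fun t => w t ^ 2 - r t * y (sigma T t) ^ 2) → H a ≤ H b

/-- Picone's inequality. -/
theorem IsSolution.isNonnegForm (h : IsInterval T a b) (hs : IsSolution T r u v)
    (hpos : ∀ t ∈ T, 0 < u t) : IsNonnegForm T a b r := by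
  intro y w H hy ya yb hH
  -- The function y² v/u vanishes at both ends because y does; its derivative is left to the product
  -- and inverse rules.
  have hW : ∀ t ∈ kappa T, HasDeltaDerivAt T (fun t => y t * y t * (u t)⁻¹ * v t) _ t :=
    fun t ht => (((hy t ht).mul (hy t ht) ht.1).mul ((hs.du t ht).inv ht.1 (hpos t ht.1).ne'
      (hpos _ (sigma_mem h.closed ht.1)).ne') ht.1).mul (hs.dv t ht) ht.1
  have := IsDeltaAntideriv.sub_le_sub h.closed hW hH h.left_mem h.right_mem h.lt.le
    fun t ht _ htb => by
      have hk := mem_kappa_of_lt ht h.right_mem htb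
      have e1 := (hy t hk).sigma_eq ht
      have e2 := (hs.du t hk).sigma_eq ht
      have p1 := hpos t ht
      have p2 := hpos _ (sigma_mem h.closed ht)
      set μ := sigma T t - t
      set ys := y (sigma T t)
      set us := u (sigma T t)
      have key : ((w t * y t + ys * w t) * (u t)⁻¹ + ys * ys * (-v t / (u t * us))) * v t
          = w t ^ 2 - (w t * u t - y t * v t) ^ 2 / (u t * us) := by
        field_simp
        rw [e1, e2]
        ring
      have h3 : 0 ≤ (w t * u t - y t * v t) ^ 2 / (u t * us) := by positivity
      have h4 : ys * ys * us⁻¹ * -(r t * us) = -(r t * ys ^ 2) := by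
        field_simp
      rw [key, h4]
      linarith
  rw [ya, yb] at this
  linarith

/-- A function positive on `(a,b]` with positive `Δ`-derivative at `a` stays positive under small
perturbations. -/
theorem exists_pos_of_close (h : IsInterval T a b) (hv : ContinuousOn v T) (hu : ContinuousOn u T)
    (hva : 0 < v a) (hpos : ∀ t ∈ T, a < t → 0 < u t) :
    ∃ η > 0, ∀ u' v' : ℝ → ℝ, IsDeltaAntideriv T u' v' → 0 ≤ u' a →
      (∀ t ∈ T, |u' t - u t| ≤ η ∧ |v' t - v t| ≤ η) → ∀ t ∈ T, a < t → 0 < u' t := by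
  obtain ⟨δ, hδ, H⟩ := Metric.continuousWithinAt_iff.1 (hv a h.left_mem) (v a / 2) (by positivity)
  obtain ⟨m, hm, hmu⟩ : ∃ m > 0, ∀ t ∈ T ∩ Set.Ici (a + δ), m ≤ u t := by
    rcases (T ∩ Set.Ici (a + δ)).eq_empty_or_nonempty with he | hne
    · exact ⟨1, one_pos, by simp [he]⟩
    · obtain ⟨x, hx, hmin⟩ := (h.isCompact.inter_right isClosed_Ici).exists_isMinOn hne
        (hu.mono Set.inter_subset_left)
      exact ⟨u x, hpos x hx.1 (by linarith [hx.2.out]), fun t ht => hmin ht⟩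
  -- Before a + δ one has v > v(a)/2, so the perturbed derivative is at least v(a)/4 and u' grows
  -- from u'(a) ≥ 0. From a + δ on, u ≥ m leaves at least m/2.
  refine ⟨min (v a / 4) (m / 2), by positivity, fun u' v' hu' h0 hc t ht hat => ?_⟩
  by_cases htδ : t < a + δ
  · have h1 := (isDeltaAntideriv_mul_id (v a / 4)).sub_le_sub h.closed hu' h.left_mem ht hat.le
      fun x hx hax hxt => by
        have e1 := (abs_le.1 ((hc x hx).2.trans (min_le_left _ _))).1
        have e2 := H hx (by rw [Real.dist_eq, abs_lt]; constructor <;> linarith)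
        rw [Real.dist_eq] at e2
        have e3 := (abs_lt.1 e2).1
        linarith
    nlinarith
  · have e1 := (abs_le.1 ((hc t ht).1.trans (min_le_right _ _))).1
    have e2 := hmu t ⟨ht, not_lt.1 htδ⟩
    linarith

/-- Picone's inequality needs positivity at a as well, where u vanishes. Adding a small multiple of
z repairs this and keeps positivity on (a,b]. -/
theorem IsSolution.isNonnegForm_of_pos (h : IsInterval T a b) (hs : IsSolution T r u v)
    (ua : u a = 0) (va : 0 < v a) (hpos : ∀ t ∈ T, a < t → 0 < u t) {z z' : ℝ → ℝ}
    (hz : IsSolution T r z z') (za : z a = 1) : IsNonnegForm T a b r := by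
  obtain ⟨η, hη, H⟩ := exists_pos_of_close h hs.continuousOn_right hs.continuousOn_left va hpos
  obtain ⟨M, hM0, hM⟩ := exists_bound h hz.continuousOn_left
  obtain ⟨N, hN0, hN⟩ := exists_bound h hz.continuousOn_right
  have hε : 0 < η / (M + N) := by positivity
  have hsum := hs.add_const_mul hz (η / (M + N))
  have hb : ∀ c, |c| ≤ M + N → |η / (M + N) * c| ≤ η := fun c hc => by
    rw [abs_mul, abs_of_pos hε]
    calc _ ≤ η / (M + N) * (M + N) := by gcongr
      _ = η := by field_simp
  refine hsum.isNonnegForm h fun t ht => ?_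
  rcases (h.subset ht).1.eq_or_lt with rfl | hat
  · rw [ua, za]; linarith
  · refine H _ _ hsum.du (by rw [ua, za]; linarith) (fun s hs' => ?_) t ht hat
    simp only [add_sub_cancel_left]
    exact ⟨hb _ (by linarith [hM s hs']), hb _ (by linarith [hN s hs'])⟩

/-- An interior zero is a minimum of u. If v(t) > 0, then u would be negative just before t; if v(t)
< 0, just after. Each case splits according to whether t is dense or scattered on that side. -/
theorem IsSolution.right_eq_zero_of_nonneg (h : IsInterval T a b) (hs : IsSolution T r u v)
    (hu : ∀ t ∈ T, 0 ≤ u t) {t : ℝ} (ht : t ∈ T) (hat : a < t) (htb : t < b) (h0 : u t = 0) :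
    v t = 0 := by
  have hk := mem_kappa_of_lt ht h.right_mem htb
  apply le_antisymm
  · by_contra! hv
    by_cases hρ : rho T t = t
    · obtain ⟨δ, hδ, H⟩ := Metric.continuousWithinAt_iff.1 (hs.continuousOn_right t ht)
        (v t / 2) (by positivity)
      obtain ⟨s, hsT, h1, h2⟩ := exists_mem_left h.left_mem hat hρ hδ
      have := (isDeltaAntideriv_mul_id (v t / 2)).sub_le_sub h.closed hs.du hsT ht h2.le
        fun x hx hsx hxt => by
          have e2 := H hx (by rw [Real.dist_eq, abs_lt]; constructor <;> linarith)
          rw [Real.dist_eq] at e2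
          have e3 := (abs_lt.1 e2).1
          linarith
      nlinarith [hu s hsT]
    · have hlt := lt_of_le_of_ne (rho_le t) hρ
      have hp := rho_mem h.closed ht
      have hpk := mem_kappa_of_lt hp ht hlt
      have e1 := (hs.du _ hpk).sigma_eq hp
      have e2 := (hs.dv _ hpk).sigma_eq hp
      -- Since u(t) = 0, the second equation gives v(ρ(t)) = v(t), and the first then makes u(ρ(t))
      -- negative.
      simp only [sigma_rho ht hlt, h0] at e1 e2
      nlinarith [hu _ hp]
  · by_contra! hv
    by_cases hσ : sigma T t = t
    · obtain ⟨δ, hδ, H⟩ := hs.du t hk (-v t / 2) (by linarith)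
      obtain ⟨s, hsT, h1, h2⟩ := exists_mem_right h.right_mem htb hσ hδ
      have := H s hsT (by rw [abs_lt]; constructor <;> linarith)
      rw [hσ, h0, abs_sub_comm t s, abs_of_pos (sub_pos.2 h1)] at this
      have := (abs_le.1 this).1
      nlinarith [hu s hsT]
    · have hlt := lt_of_le_of_ne (le_sigma (T := T) t) (Ne.symm hσ)
      have e1 := (hs.du t hk).sigma_eq ht
      nlinarith [hu _ (sigma_mem h.closed ht)]

/-! ### Nontrivial functions and the first eigenvalue -/

/-- `∫_a^b (y^σ)² Δt > 0` for nontrivial `y`. -/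
theorem lt_of_antideriv_sq (h : IsInterval T a b) {y G : ℝ → ℝ} (hy : ContinuousOn y T)
    (ya : y a = 0) (hG : IsDeltaAntideriv T G (fun t => y (sigma T t) ^ 2))
    (hne : ∃ t ∈ T, y t ≠ 0) : G a < G b := by
  by_contra! hle
  have hmono : ∀ s ∈ T, ∀ t ∈ T, s ≤ t → G s ≤ G t := fun s hs t ht hst =>
    hG.le_of_nonneg h.closed hs ht hst fun _ _ _ _ => sq_nonneg _
  have hconst : ∀ t ∈ T, G t = G a := fun t ht => le_antisymm
    ((hmono t ht b h.right_mem (h.subset ht).2).trans hle) (hmono a h.left_mem t ht (h.subset ht).1)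
  have hσ : ∀ t ∈ kappa T, y (sigma T t) = 0 := fun t ht => by
    have h1 := (hasDeltaDerivAt_const (G a) ht.1).congr h.closed ht.1 hconst
    exact pow_eq_zero_iff two_ne_zero |>.1 ((hG t ht).unique h1 ht (h.exists_ne t))
  obtain ⟨t, ht, hyt⟩ := hne
  rcases (h.subset ht).1.eq_or_lt with rfl | hat
  · exact hyt ya
  -- If t is left-dense, the points σ(s) with s < t are zeros of y approaching t; otherwise t =
  -- σ(ρ(t)) is itself such a zero.
  by_cases hρ : rho T t = t
  · obtain ⟨δ, hδ, H⟩ := Metric.continuousWithinAt_iff.1 (hy t ht) |y t| (abs_pos.2 hyt)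
    obtain ⟨s, hs, h1, h2⟩ := exists_mem_left h.left_mem hat hρ hδ
    have h3 := sigma_le ht h2
    have h4 := le_sigma (T := T) s
    have := H (sigma_mem h.closed hs) (by rw [Real.dist_eq, abs_lt]; constructor <;> linarith)
    rw [hσ s (mem_kappa_of_lt hs ht h2), Real.dist_eq, zero_sub, abs_neg] at this
    exact this.false
  · have hlt := lt_of_le_of_ne (rho_le t) hρ
    have := hσ _ (mem_kappa_of_lt (rho_mem h.closed ht) ht hlt)
    rw [sigma_rho ht hlt] at this
    exact hyt this

/-- Integrate t - c, with c chosen so that the integral over [a,b] vanishes. This derivative cannot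
be zero at both a and p, so the function is nontrivial. -/
theorem exists_test_function (h : IsInterval T a b) (hp : ∃ p ∈ kappa T, a < p) :
    ∃ y w : ℝ → ℝ, IsDeltaAntideriv T y w ∧ ContinuousOn w T ∧ y a = 0 ∧ y b = 0 ∧
      ∃ t ∈ T, y t ≠ 0 := by
  obtain ⟨F, hF⟩ := (regular_of_continuousOn h continuousOn_id).exists_antideriv h
  set c := (F b - F a) / (b - a) with hc
  have hab := sub_pos.2 h.lt
  have hy : IsDeltaAntideriv T (fun t => F t - F a - (c * t - c * a)) (fun t => t - c) := by
    intro t ht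
    have := ((hF t ht).sub (hasDeltaDerivAt_const (F a) ht.1) ht.1).sub
      ((isDeltaAntideriv_mul_id c t ht).sub (hasDeltaDerivAt_const (c * a) ht.1) ht.1) ht.1
    simpa using this
  refine ⟨_, _, hy, by fun_prop, by ring, ?_, ?_⟩
  · rw [hc]; field_simp; ring
  by_contra! hz
  have hw : ∀ t ∈ kappa T, t - c = 0 := fun t ht =>
    (hy t ht).unique ((hasDeltaDerivAt_const 0 ht.1).congr h.closed ht.1 hz) ht (h.exists_ne t)
  obtain ⟨p, hp, hap⟩ := hp
  linarith [hw p hp, hw a (mem_kappa_of_lt h.left_mem h.right_mem h.lt)]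

theorem exists_first_solution (h : IsInterval T a b) (hp : ∃ p ∈ kappa T, a < p) {q : ℝ → ℝ}
    (hq : ContinuousOn q T) : ∃ l : ℝ, ∃ u v : ℝ → ℝ, IsSolution T (fun t => q t + l) u v ∧
      u a = 0 ∧ v a = 1 ∧ u b = 0 ∧ IsNonnegForm T a b (fun t => q t + l) := by
  obtain ⟨u, v, hs, hc, hpos⟩ := exists_solution_family h hq 0 1
  obtain ⟨z, z', hz, -, -⟩ := exists_solution_family h hq 1 0
  set Λ : Set ℝ := {l | ∀ t ∈ T, a < t → 0 < u l t} with hΛ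
  have hform : ∀ l ∈ Λ, IsNonnegForm T a b (fun t => q t + l) := fun l hl =>
    (hs l).1.isNonnegForm_of_pos h (hs l).2.1 (by rw [(hs l).2.2]; exact one_pos) hl
      (hz l).1 (hz l).2.1
  have hne : Λ.Nonempty := by
    obtain ⟨M, -, hM⟩ := exists_bound h hq
    refine ⟨-M, fun t ht hat => ?_⟩
    have := hpos le_rfl zero_le_one (-M) (fun t ht => by linarith [le_abs_self (q t), hM t ht]) t ht
    linarith
  -- Nonnegativity of the form on the test function bounds l by its Rayleigh quotient.
  have hbdd : BddAbove Λ := by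
    obtain ⟨y, w, hy, hw, ya, yb, hy0⟩ := exists_test_function h hp
    obtain ⟨G, hG⟩ := ((regular_comp_sigma h (hy.continuousOn.pow 2)).exists_antideriv h)
    obtain ⟨H, hH⟩ := ((regular_of_continuousOn h (hw.pow 2)).add
      (regular_mul_comp_sigma h hq.neg (hy.continuousOn.pow 2))).exists_antideriv h
    have hGpos := sub_pos.2 (lt_of_antideriv_sq h hy.continuousOn ya hG hy0)
    refine ⟨(H b - H a) / (G b - G a), fun l hl => ?_⟩
    rw [le_div_iff₀ hGpos]
    have := hform l hl y w (fun t => H t - l * G t) hy ya yb fun t ht => by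
      convert (hH t ht).sub ((hG t ht).const_mul l ht.1) ht.1 using 1
      simp only [Pi.pow_apply, Pi.neg_apply]
      ring
    linarith
  set l := sSup Λ
  have hfreq : ∃ᶠ x in 𝓝 l, x ∈ Λ := mem_closure_iff_frequently.1 (csSup_mem_closure hne hbdd)
  have hu0 : ∀ t ∈ T, 0 ≤ u l t := by
    intro t ht
    by_contra! hneg
    obtain ⟨x, hx, hxc⟩ := (hfreq.and_eventually (hc l (-u l t / 2) (by linarith))).exists
    have e1 := (abs_le.1 (hxc t ht).1).2
    rcases (h.subset ht).1.eq_or_lt with rfl | hat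
    · rw [(hs l).2.1] at hneg; exact hneg.false
    · linarith [hx t ht hat]
  refine ⟨l, u l, v l, (hs l).1, (hs l).2.1, (hs l).2.2, ?_, ?_⟩
  · by_contra hub
    have hlpos : ∀ t ∈ T, a < t → 0 < u l t := by
      intro t ht hat
      refine lt_of_le_of_ne (hu0 t ht) fun h0 => ?_
      have htb : t < b := lt_of_le_of_ne (h.subset ht).2 fun hb => hub (hb ▸ h0.symm)
      have hv := (hs l).1.right_eq_zero_of_nonneg h hu0 ht hat htb h0.symm
      -- The Wronskian of u and z is -1 at a, but would be 0 at a common zero of u and v.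
      have hw := (hs l).1.wronskian_eq h (hz l).1 ht
      rw [← h0, hv, (hs l).2.1, (hs l).2.2, (hz l).2.1] at hw
      norm_num at hw
    obtain ⟨η, hη, H⟩ := exists_pos_of_close h (hs l).1.continuousOn_right
      (hs l).1.continuousOn_left (by rw [(hs l).2.2]; exact one_pos) hlpos
    -- Positivity on (a,b] persists for parameters slightly above the supremum, a contradiction.
    obtain ⟨x, hx, hlx⟩ := (((hc l η hη).filter_mono nhdsWithin_le_nhds).and
      (self_mem_nhdsWithin (s := Set.Ioi l))).exists
    exact not_lt.2 (le_csSup hbdd (show x ∈ Λ from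
      H _ _ (hs x).1.du (hs x).2.1.ge hx)) hlx
  · intro y w H hy ya yb hH
    obtain ⟨G, hG⟩ := ((regular_comp_sigma h (hy.continuousOn.pow 2)).exists_antideriv h)
    have hGm : G a ≤ G b := hG.le_of_nonneg h.closed h.left_mem h.right_mem h.lt.le
      fun x _ _ _ => sq_nonneg _
    by_contra! hlt
    -- The added 1 avoids dividing by zero when I[y] = 0. A parameter x in Λ close enough to l then
    -- contradicts a negative value of the form at l.
    have hd : 0 < G b - G a + 1 := by linarith
    obtain ⟨x, hx, hxl⟩ := exists_lt_of_lt_csSup hne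
      (show l - (H a - H b) / (G b - G a + 1) < sSup Λ by
        have : 0 < (H a - H b) / (G b - G a + 1) := div_pos (by linarith) hd
        linarith)
    have h1 := hform x hx y w (fun t => H t + (l - x) * G t) hy ya yb fun t ht => by
      convert (hH t ht).add ((hG t ht).const_mul (l - x) ht.1) ht.1 using 1
      simp only [Pi.pow_apply]
      ring
    have h2 : (l - x) * (G b - G a + 1) < H a - H b := by
      rw [← lt_div_iff₀ hd]; linarith
    have h3 : 0 ≤ l - x := sub_nonneg.2 (le_csSup hbdd hx)
    nlinarith

end TimeScale

namespace TimeScale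

variable {T : Set ℝ} {a b : ℝ} {q y : ℝ → ℝ} {l : ℝ}

/-! ### The time scale `T^κ` -/

theorem kappa_eq (h : IsInterval T a b) : kappa T = T ∩ Set.Iic (rho T b) := by
  ext t
  constructor
  · rintro ⟨ht, ⟨s, hs, hts⟩ | hr⟩
    · exact ⟨ht, le_rho ht (hts.trans_le (h.subset hs).2)⟩
    · refine ⟨ht, ?_⟩
      rcases (h.subset ht).2.eq_or_lt with rfl | htb
      · exact hr.ge
      · exact le_rho ht htb
  · rintro ⟨ht, hr⟩
    rcases (h.subset ht).2.eq_or_lt with rfl | htb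
    · exact ⟨ht, Or.inr (le_antisymm (rho_le t) hr)⟩
    · exact mem_kappa_of_lt ht h.right_mem htb

theorem isClosed_kappa (h : IsInterval T a b) : IsClosed (kappa T) := by
  rw [kappa_eq h]
  exact h.closed.inter isClosed_Iic

theorem rho_mem_kappa (h : IsInterval T a b) : rho T b ∈ kappa T := by
  rw [kappa_eq h]
  exact ⟨rho_mem h.closed h.right_mem, Set.self_mem_Iic⟩

theorem kappa_eq_self (h : IsInterval T a b) (hb : rho T b = b) : kappa T = T := by
  rw [kappa_eq h, hb]
  exact Set.inter_eq_left.2 fun t ht => (h.subset ht).2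

theorem exists_mem_kappa_gt (h : IsInterval T a b) (hρ : rho T b < b → rho T (rho T b) < rho T b) :
    ∃ p ∈ kappa T, a < p := by
  refine ⟨rho T b, rho_mem_kappa h, ?_⟩
  rcases (rho_le (T := T) b).eq_or_lt with hb | hb
  · rw [hb]; exact h.lt
  · exact (h.subset (rho_mem h.closed (rho_mem h.closed h.right_mem))).1.trans_lt (hρ hb)

theorem exists_mem_kappa_ne (h : IsInterval T a b)
    (hρ : rho T b < b → rho T (rho T b) < rho T b) (t : ℝ) : ∃ s ∈ kappa T, s ≠ t := by
  obtain ⟨p, hp, hap⟩ := exists_mem_kappa_gt h hρ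
  by_cases hta : t = a
  · exact ⟨p, hp, hta ▸ hap.ne'⟩
  · exact ⟨a, mem_kappa_of_lt h.left_mem h.right_mem h.lt, Ne.symm hta⟩

/-- When b is left-scattered, ρ(b) is the maximum of T^κ and is left-scattered by hypothesis, so the
second κ removes it. This excludes the one point of T^κ where its σ differs from that of T. -/
theorem lt_rho_of_mem_kappa_kappa (h : IsInterval T a b)
    (hρ : rho T b < b → rho T (rho T b) < rho T b) (hb : rho T b < b) {t : ℝ}
    (ht : t ∈ kappa (kappa T)) : t < rho T b := by
  have hle : ∀ s ∈ kappa T, s ≤ rho T b := fun s hs => by rw [kappa_eq h] at hs; exact hs.2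
  rcases ht.2 with ⟨s, hs, hts⟩ | hr
  · exact hts.trans_le (hle s hs)
  refine lt_of_le_of_ne (hle t ht.1) fun he => ?_
  subst he
  have hm := rho_mem h.closed h.right_mem
  obtain ⟨u, hu, h1, h2⟩ := exists_mem_left
    (mem_kappa_of_lt (rho_mem h.closed hm) hm (hρ hb)) (hρ hb) hr (sub_pos.2 (hρ hb))
  linarith [le_rho hu.1 h2]

theorem sigma_kappa (h : IsInterval T a b) {t : ℝ} (hb : rho T b < b) (ht : t < rho T b) :
    sigma (kappa T) t = sigma T t := by
  have hc := rho_mem_kappa h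
  apply le_antisymm
  · nth_rw 2 [sigma]
    rw [if_pos ⟨_, hc.1, ht⟩]
    refine le_csInf ⟨_, hc.1, ht⟩ fun s hs => ?_
    rcases (h.subset hs.1).2.eq_or_lt with rfl | hsb
    · exact (sigma_le hc ht).trans hb.le
    · exact sigma_le (mem_kappa_of_lt hs.1 h.right_mem hsb) hs.2
  · nth_rw 2 [sigma]
    rw [if_pos ⟨_, hc, ht⟩]
    exact le_csInf ⟨_, hc, ht⟩ fun s hs => sigma_le hs.1.1 hs.2

theorem hasDeltaDerivAt_kappa_iff (h : IsInterval T a b)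
    (hρ : rho T b < b → rho T (rho T b) < rho T b) {f : ℝ → ℝ} {d t : ℝ}
    (ht : t ∈ kappa (kappa T)) : HasDeltaDerivAt (kappa T) f d t ↔ HasDeltaDerivAt T f d t := by
  rcases (rho_le (T := T) b).eq_or_lt with hb | hb
  · rw [kappa_eq_self h hb]
  have htc := lt_rho_of_mem_kappa_kappa h hρ hb ht
  have hσ := sigma_kappa h hb htc
  constructor
  · intro H ε hε
    obtain ⟨δ, hδ, H⟩ := H ε hε
    refine ⟨min δ (b - t), lt_min hδ (by linarith), fun s hs hst => ?_⟩
    rw [← hσ]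
    have h2 := abs_lt.1 (hst.trans_le (min_le_right _ _))
    exact H s (mem_kappa_of_lt hs h.right_mem (by linarith)) (hst.trans_le (min_le_left _ _))
  · intro H ε hε
    obtain ⟨δ, hδ, H⟩ := H ε hε
    refine ⟨δ, hδ, fun s hs hst => ?_⟩
    rw [hσ]
    exact H s hs.1 hst

/-! ### Eigenfunctions and solutions -/

theorem TwiceDeltaDifferentiable.isDeltaAntideriv (hy : TwiceDeltaDifferentiable T y) :
    IsDeltaAntideriv T y (deltaDeriv T y) := fun t ht => (hy.1 t ht).hasDeltaDerivAt

theorem TwiceDeltaDifferentiable.continuousOn_deltaDeriv (hy : TwiceDeltaDifferentiable T y) :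
    ContinuousOn (deltaDeriv T y) T :=
  continuousOn_of_continuousOn_kappa <| continuousOn_of_kappa fun t ht =>
    (hy.2 t ht).hasDeltaDerivAt.continuousWithinAt ht.1

theorem IsSolution.isEigenfunction (h : IsInterval T a b)
    (hρ : rho T b < b → rho T (rho T b) < rho T b) {u v : ℝ → ℝ}
    (hs : IsSolution T (fun t => q t + l) u v) (ua : u a = 0) (va : v a ≠ 0) (ub : u b = 0) :
    IsEigenfunction T a b q l u := by
  have hd2 : ∀ t ∈ kappa (kappa T), HasDeltaDerivAt (kappa T) (deltaDeriv T u)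
      (-((q t + l) * u (sigma T t))) t := fun t ht =>
    ((hasDeltaDerivAt_kappa_iff h hρ ht).2 (hs.dv t ht.1)).congr (isClosed_kappa h) ht.1
      fun s hs' => (hs.du s hs').deltaDeriv_eq hs' (h.exists_ne s)
  refine ⟨⟨fun t ht => ⟨_, hs.du t ht⟩, fun t ht => ⟨_, hd2 t ht⟩⟩, fun t ht => ?_, ua, ub, ?_⟩
  · rw [deltaDeriv2, (hd2 t ht).deltaDeriv_eq ht (exists_mem_kappa_ne h hρ t)]
    ring
  · by_contra! h0
    have ha := mem_kappa_of_lt h.left_mem h.right_mem h.lt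
    exact va ((hs.du a ha).unique ((hasDeltaDerivAt_const 0 ha.1).congr h.closed ha.1 h0) ha
      (h.exists_ne a))

theorem IsEigenfunction.deltaDeriv2_eq (he : IsEigenfunction T a b q l y) {t : ℝ}
    (ht : t ∈ kappa (kappa T)) : deltaDeriv2 T y t = -((q t + l) * y (sigma T t)) := by
  linarith [he.eqn t ht]

/-- The derivative of an eigenfunction, extended by its value at `ρ(b)` to `b`, completes the
eigenfunction to a solution of the first order system. -/
theorem IsEigenfunction.isSolution (h : IsInterval T a b)
    (hρ : rho T b < b → rho T (rho T b) < rho T b) (he : IsEigenfunction T a b q l y) :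
    IsSolution T (fun t => q t + l) y
      (Function.update (deltaDeriv T y) b (deltaDeriv T y (rho T b))) := by
  set w := deltaDeriv T y with hw
  set v := Function.update w b (w (rho T b)) with hv
  have hvw : ∀ t ∈ kappa T, v t = w t := fun t ht => by
    by_cases htb : t = b
    · rw [kappa_eq h] at ht
      have : rho T b = b := le_antisymm (rho_le b) (htb ▸ ht.2)
      rw [htb, hv, Function.update_self, this]
    · rw [hv, Function.update_of_ne htb]
  refine ⟨fun t ht => ?_, fun t ht => ?_⟩
  · rw [hvw t ht]
    exact he.twice.isDeltaAntideriv t ht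
  beta_reduce
  by_cases hk : t ∈ kappa (kappa T)
  · rw [← he.deltaDeriv2_eq hk, ← hasDeltaDerivAt_kappa_iff h hρ hk]
    exact (he.twice.2 t hk).hasDeltaDerivAt.congr (isClosed_kappa h) ht hvw
  · have hc := rho_mem_kappa h
    have htc : t = rho T b := by
      refine le_antisymm ?_ (not_lt.1 fun hlt => hk (mem_kappa_of_lt ht hc hlt))
      rw [kappa_eq h] at ht
      exact ht.2
    have hb : rho T b < b := lt_of_le_of_ne (rho_le b) fun hb => hk (by
      rw [kappa_eq_self h hb, kappa_eq_self h hb]; exact ht.1)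
    have hσ := sigma_rho h.right_mem hb
    intro ε hε
    have hr := hρ hb
    -- The remaining point ρ(b) is isolated on both sides, and this radius leaves only s = ρ(b).
    -- There σ(s) = b, y(b) = 0 and v(b) = v(ρ(b)), so both sides of v^Δ = -(q + l) y^σ vanish.
    refine ⟨min (b - t) (t - rho T t), ?_, fun s hs hst => ?_⟩
    · rw [htc]; exact lt_min (by linarith) (by linarith)
    have h1 := abs_lt.1 (hst.trans_le (min_le_left _ _))
    have h2 := abs_lt.1 (hst.trans_le (min_le_right _ _))
    have hst' : s = rho T b := by
      refine le_antisymm (le_rho hs (by linarith)) (not_lt.1 fun hlt => ?_)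
      rw [← htc] at hlt
      linarith [le_rho hs hlt]
    have hvb : v b = v (rho T b) := by
      rw [hvw _ hc, hv, Function.update_self]
    rw [hst', htc, hσ, he.right, hvb]
    simp
    positivity

/-! ### The functionals -/

theorem functionalI_eq (h : IsInterval T a b) {G : ℝ → ℝ}
    (hG : IsDeltaAntideriv T G (fun t => y (sigma T t) ^ 2)) :
    functionalI T a b y = G b - G a :=
  deltaIntegral_eq h.closed hG h.left_mem h.right_mem h.lt.le

theorem exists_antideriv_sq (h : IsInterval T a b) (hy : ContinuousOn y T) :
    ∃ G, IsDeltaAntideriv T G (fun t => y (sigma T t) ^ 2) :=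
  (regular_comp_sigma h (hy.pow 2)).exists_antideriv h

theorem functionalI_const_mul (h : IsInterval T a b) (hy : ContinuousOn y T) (c : ℝ) :
    functionalI T a b (fun t => c * y t) = c ^ 2 * functionalI T a b y := by
  obtain ⟨G, hG⟩ := exists_antideriv_sq h hy
  rw [functionalI_eq h hG, functionalI_eq h (G := fun t => c ^ 2 * G t) fun t ht => by
    beta_reduce; rw [mul_pow]; exact (hG t ht).const_mul _ ht.1]
  ring

/-- `J[y] - l I[y]` is the integral of `(y^Δ)² - (q + l) (y^σ)²`. -/
theorem exists_antideriv_form (h : IsInterval T a b) (hq : ContinuousOn q T)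
    (hy : TwiceDeltaDifferentiable T y) (l : ℝ) :
    ∃ H, IsDeltaAntideriv T H
        (fun t => deltaDeriv T y t ^ 2 - (q t + l) * y (sigma T t) ^ 2) ∧
      functionalJ T a b q y - l * functionalI T a b y = H b - H a := by
  have hyc := hy.isDeltaAntideriv.continuousOn
  obtain ⟨G, hG⟩ := exists_antideriv_sq h hyc
  obtain ⟨H, hH⟩ := ((regular_of_continuousOn h (hy.continuousOn_deltaDeriv.pow 2)).add
    (regular_mul_comp_sigma h hq.neg (hyc.pow 2))).exists_antideriv h
  have hH' : IsDeltaAntideriv T H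
      (fun t => deltaDeriv T y t ^ 2 - q t * y (sigma T t) ^ 2) := fun t ht => by
    convert hH t ht using 1
    simp only [Pi.pow_apply, Pi.neg_apply]
    ring
  refine ⟨fun t => H t - l * G t, fun t ht => ?_, ?_⟩
  · convert (hH' t ht).sub ((hG t ht).const_mul l ht.1) ht.1 using 1
    ring
  · rw [functionalI_eq h hG, functionalJ,
      deltaIntegral_eq h.closed hH' h.left_mem h.right_mem h.lt.le]
    ring

/-- The product y v is an antiderivative of (y^Δ)² - (q + l)(y^σ)², by the product rule and the
equation, and it vanishes at both ends. -/
theorem IsEigenfunction.functionalJ_eq (h : IsInterval T a b)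
    (hρ : rho T b < b → rho T (rho T b) < rho T b) (hq : ContinuousOn q T)
    (he : IsEigenfunction T a b q l y) :
    functionalJ T a b q y = l * functionalI T a b y := by
  obtain ⟨H, hH, hJ⟩ := exists_antideriv_form h hq he.twice l
  have hs := he.isSolution h hρ
  set v := Function.update (deltaDeriv T y) b (deltaDeriv T y (rho T b))
  have hyv : IsDeltaAntideriv T (fun t => y t * v t)
      (fun t => deltaDeriv T y t ^ 2 - (q t + l) * y (sigma T t) ^ 2) := fun t ht => by
    convert (hs.du t ht).mul (hs.dv t ht) ht.1 using 1
    beta_reduce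
    rw [(hs.du t ht).deltaDeriv_eq ht (h.exists_ne t)]
    ring
  have e1 := deltaIntegral_eq h.closed hH h.left_mem h.right_mem h.lt.le
  have e2 := deltaIntegral_eq h.closed hyv h.left_mem h.right_mem h.lt.le
  rw [e1, he.left, he.right] at e2
  linarith

theorem IsEigenfunction.functionalI_pos (h : IsInterval T a b)
    (he : IsEigenfunction T a b q l y) : 0 < functionalI T a b y := by
  have hyc := he.twice.isDeltaAntideriv.continuousOn
  obtain ⟨G, hG⟩ := exists_antideriv_sq h hyc
  rw [functionalI_eq h hG]
  exact sub_pos.2 (lt_of_antideriv_sq h hyc he.left hG he.nontrivial)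

theorem IsNonnegForm.le_functionalJ (h : IsInterval T a b) (hq : ContinuousOn q T)
    (hf : IsNonnegForm T a b (fun t => q t + l)) (hy : TwiceDeltaDifferentiable T y)
    (ya : y a = 0) (yb : y b = 0) : l * functionalI T a b y ≤ functionalJ T a b q y := by
  obtain ⟨H, hH, hJ⟩ := exists_antideriv_form h hq hy l
  have := hf y _ H hy.isDeltaAntideriv ya yb hH
  linarith

/-- The equation gives y^{Δ²} = -(q + l) y^σ with q and y continuous. Only σ can be discontinuous,
and it is continuous at right-dense points and tends to t from the left. -/
theorem IsEigenfunction.c2rd (h : IsInterval T a b) (hq : ContinuousOn q T)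
    (he : IsEigenfunction T a b q l y) : C2rd T y := by
  have hyc := he.twice.isDeltaAntideriv.continuousOn
  have hql : ContinuousOn (fun t => -(q t + l)) T := (hq.add continuousOn_const).neg
  have hsub : kappa (kappa T) ⊆ T := kappa_subset.trans kappa_subset
  have heq : ∀ t ∈ kappa (kappa T), deltaDeriv2 T y t = -(q t + l) * y (sigma T t) :=
    fun t ht => by rw [he.deltaDeriv2_eq ht]; ring
  refine ⟨he.twice, fun t ht => ⟨fun hσ => ?_, fun _ => ⟨-(q t + l) * y t, ?_⟩⟩⟩
  · exact (((regular_mul_comp_sigma h hql hyc).cont t (hsub ht) hσ).mono hsub).congr heq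
      (heq t ht)
  · have h1 : Tendsto (fun s => -(q s + l) * y (sigma T s)) (𝓝[T ∩ Set.Iio t] t)
        (𝓝 (-(q t + l) * y t)) := by
      refine ((hql t (hsub ht)).mono_left (nhdsWithin_mono _ Set.inter_subset_left)).mul ?_
      refine Tendsto.comp (hyc t (hsub ht)) (tendsto_nhdsWithin_iff.2
        ⟨tendsto_sigma_left (hsub ht), ?_⟩)
      filter_upwards [self_mem_nhdsWithin] with s hs using sigma_mem h.closed hs.1
    refine (h1.mono_left (nhdsWithin_mono _ (Set.inter_subset_inter_left _ hsub))).congr' ?_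
    filter_upwards [self_mem_nhdsWithin] with s hs using (heq s hs.1).symm

theorem isInterval_tsIcc {𝕋 : Set ℝ} (h𝕋 : IsClosed 𝕋) (ha : a ∈ 𝕋) (hb : b ∈ 𝕋) (hab : a < b) :
    IsInterval (tsIcc 𝕋 a b) a b :=
  ⟨h𝕋.inter isClosed_Icc, ⟨ha, le_rfl, hab.le⟩, ⟨hb, hab.le, le_rfl⟩, fun _ ht => ht.2, hab⟩

end TimeScale

/-! ### Variational characterisation of the least eigenvalue -/

theorem theoremT2 (𝕋 : Set ℝ) (h𝕋 : IsClosed 𝕋) (a b : ℝ) (ha : a ∈ 𝕋) (hb : b ∈ 𝕋)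
    (hab : a < b)
    (hρ : TimeScale.rho (TimeScale.tsIcc 𝕋 a b) b < b →
      TimeScale.rho (TimeScale.tsIcc 𝕋 a b) (TimeScale.rho (TimeScale.tsIcc 𝕋 a b) b) <
        TimeScale.rho (TimeScale.tsIcc 𝕋 a b) b)
    (q : ℝ → ℝ) (hq : ContinuousOn q (TimeScale.kappa (TimeScale.tsIcc 𝕋 a b))) :
    (∃ lam₁ : ℝ, TimeScale.IsFirstEigenvalue (TimeScale.tsIcc 𝕋 a b) a b q lam₁) ∧
    ∀ lam₁ : ℝ, TimeScale.IsFirstEigenvalue (TimeScale.tsIcc 𝕋 a b) a b q lam₁ →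
      (∃ y₁ : ℝ → ℝ, TimeScale.IsEigenfunction (TimeScale.tsIcc 𝕋 a b) a b q lam₁ y₁ ∧
        TimeScale.functionalI (TimeScale.tsIcc 𝕋 a b) a b y₁ = 1) ∧
      ∀ y₁ : ℝ → ℝ, TimeScale.IsEigenfunction (TimeScale.tsIcc 𝕋 a b) a b q lam₁ y₁ →
        TimeScale.functionalI (TimeScale.tsIcc 𝕋 a b) a b y₁ = 1 →
        TimeScale.IsAdmissible (TimeScale.tsIcc 𝕋 a b) a b y₁ ∧
        (∀ y : ℝ → ℝ, TimeScale.IsAdmissible (TimeScale.tsIcc 𝕋 a b) a b y →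
          TimeScale.functionalJ (TimeScale.tsIcc 𝕋 a b) a b q y₁ ≤
            TimeScale.functionalJ (TimeScale.tsIcc 𝕋 a b) a b q y) ∧
        TimeScale.functionalJ (TimeScale.tsIcc 𝕋 a b) a b q y₁ = lam₁ := by
  have h := TimeScale.isInterval_tsIcc h𝕋 ha hb hab
  have hqT := TimeScale.continuousOn_of_continuousOn_kappa hq
  obtain ⟨l, u, v, hs, ua, va, ub, hf⟩ :=
    TimeScale.exists_first_solution h (TimeScale.exists_mem_kappa_gt h hρ) hqT
  have hu := hs.isEigenfunction h hρ ua (by rw [va]; exact one_ne_zero) ub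
  have hfirst : TimeScale.IsFirstEigenvalue (TimeScale.tsIcc 𝕋 a b) a b q l := by
    refine ⟨⟨u, hu⟩, ?_⟩
    rintro l' ⟨y, hy⟩
    -- For an eigenfunction of l' this reads l I[y] ≤ l' I[y], and I[y] > 0.
    have h1 := hf.le_functionalJ h hqT hy.twice hy.left hy.right
    rw [hy.functionalJ_eq h hρ hqT] at h1
    exact le_of_mul_le_mul_right h1 (hy.functionalI_pos h)
  refine ⟨⟨l, hfirst⟩, fun lam₁ hlam => ?_⟩
  obtain rfl : lam₁ = l := hlam.unique hfirst
  refine ⟨?_, fun y₁ hy₁ hI => ?_⟩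
  · have hI := hu.functionalI_pos h
    set c := (Real.sqrt (TimeScale.functionalI (TimeScale.tsIcc 𝕋 a b) a b u))⁻¹ with hc
    have hcpos : 0 < c := inv_pos.2 (Real.sqrt_pos.2 hI)
    -- The normalised multiple c u is written as u + (c - 1) u, to reuse linearity of the system;
    -- its derivative at a is c.
    have hsc := (hs.add_const_mul hs (c - 1))
    have hcu : (fun t => u t + (c - 1) * u t) = fun t => c * u t := by ext t; ring
    refine ⟨fun t => c * u t, ?_, ?_⟩
    · rw [hcu] at hsc
      refine hsc.isEigenfunction h hρ (by simp [ua]) ?_ (by simp [ub])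
      rw [va]
      linarith
    · rw [TimeScale.functionalI_const_mul h hs.continuousOn_left, hc, inv_pow,
        Real.sq_sqrt hI.le, inv_mul_cancel₀ hI.ne']
  · have hJ : TimeScale.functionalJ (TimeScale.tsIcc 𝕋 a b) a b q y₁ = lam₁ := by
      rw [hy₁.functionalJ_eq h hρ hqT, hI, mul_one]
    refine ⟨⟨hy₁.c2rd h hqT, hy₁.left, hy₁.right, hI⟩, fun y hy => ?_, hJ⟩
    have := hf.le_functionalJ h hqT hy.c2rd.1 hy.left hy.right
    rwa [hy.constraint, mul_one, ← hJ] at this
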